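/- Let $\varepsilon>0$ and $d\ge 0$. For $\theta\in\mathbb{R}^{d\times d}$ put $$\Psi_\varepsilon(\theta)=e^{-\frac1{2\varepsilon}}\sum_{n=0}^{\infty}\Bigl(\frac1{(2n)!}+\frac1{2\varepsilon(2n+1)!}\Bigr)\Bigl(\frac{\theta}{\varepsilon}+\frac{\mathrm{Id}_d}{4\varepsilon^2}\Bigr)^n ,$$ and let $$\lambda_\varepsilon=\min_{\alpha\in\mathbb{R}} e^{-\frac1{2\varepsilon}}\Bigl(\cos\alpha+\frac{\sin\alpha}{2\varepsilon\alpha}\Bigr),$$ where $\frac{\sin\alpha}{\alpha}$ is read as $1$ at $\alpha=0$; this minimum is attained. The series $\Psi_\varepsilon(\theta)$ converges, and $x_0\mapsto\Psi_\varepsilon(\theta)x_0$ is the time-$1$ map $x_0\mapsto x(1)$ of the linear equation $$\varepsilon\ddot x+\dot x=\theta x,\qquad x(0)=x_0,\quad \dot x(0)=0 .$$ Say that $D\in\mathbb{R}^{d\times d}$ is represented if it is the time-$1$ map of this equation, i.e. $D=\Psi_\varepsilon(\theta)$, for some $\theta\in\mathbb{R}^{d\times d}$. 1. (Diagonalizable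 case.) Let $D\in\mathbb{R}^{d\times d}$ be diagonalizable over $\mathbb{C}$. Then $D$ is represented if and only if every real eigenvalue $\lambda$ of $D$ with $\lambda<\lambda_\varepsilon$ has even (algebraic) multiplicity. 2. (General case.) Let $A\in\mathbb{R}^{d\times d}$, and take any Jordan normal form of $A$ over $\mathbb{C}$ (one exists). (a) If $A$ is represented, then for every real $\lambda<\lambda_\varepsilon$ and every $k\ge1$ the number of $k\times k$ Jordan blocks in it with eigenvalue $\lambda$ is even. (b) Conversely, if for every real $\lambda\le\lambda_\varepsilon$ and every $k\ge1$ the number of $k\times k$ Jordan blocks in it with eigenvalue $\lambda$ is even, then $A$ is represented. -/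

import Mathlib

noncomputable section

namespace SecondOrderLinear

/-- `x` is a (twice differentiable) solution on `[0, 1]` of `ε x'' + x' = θ x` with initial
position `x 0 = x₀` and initial velocity `x' 0 = 0`; `v` and `a` are the first and second
derivatives of `x` (one-sided at the end points). -/
def IsSolution {d : ℕ} (ε : ℝ) (θ : Matrix (Fin d) (Fin d) ℝ) (x₀ : Fin d → ℝ)
    (x : ℝ → Fin d → ℝ) : Prop :=
  ∃ v a : ℝ → Fin d → ℝ,
    (∀ t ∈ Set.Icc (0 : ℝ) 1, HasDerivWithinAt x (v t) (Set.Icc 0 1) t) ∧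
    (∀ t ∈ Set.Icc (0 : ℝ) 1, HasDerivWithinAt v (a t) (Set.Icc 0 1) t) ∧
    (∀ t ∈ Set.Icc (0 : ℝ) 1, ε • a t + v t = θ.mulVec (x t)) ∧
    x 0 = x₀ ∧ v 0 = 0

/-- `D` is the time-`1` map `x₀ ↦ x(1)` of `ε x'' + x' = θ x`, `x 0 = x₀`, `x' 0 = 0`:
for every `x₀` a solution exists, and every solution takes the value `D x₀` at time `1`. -/
def IsTimeOneMap {d : ℕ} (ε : ℝ) (θ D : Matrix (Fin d) (Fin d) ℝ) : Prop :=
  ∀ x₀ : Fin d → ℝ, (∃ x, IsSolution ε θ x₀ x) ∧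
    ∀ x, IsSolution ε θ x₀ x → x 1 = D.mulVec x₀

/-- `D` is represented by the second-order linear model. -/
def IsRepresented {d : ℕ} (ε : ℝ) (D : Matrix (Fin d) (Fin d) ℝ) : Prop :=
  ∃ θ : Matrix (Fin d) (Fin d) ℝ, IsTimeOneMap ε θ D

/-- The `n`-th term of the power series in `θ / ε + Id / (4 ε²)` that defines `Ψ_ε(θ)`. -/
def psiTerm {d : ℕ} (ε : ℝ) (θ : Matrix (Fin d) (Fin d) ℝ) (n : ℕ) :
    Matrix (Fin d) (Fin d) ℝ :=
  (1 / ((2 * n).factorial : ℝ) + 1 / (2 * ε * ((2 * n + 1).factorial : ℝ))) •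
    ((1 / ε) • θ + (1 / (4 * ε ^ 2)) • (1 : Matrix (Fin d) (Fin d) ℝ)) ^ n

/-- The matrix function `Ψ_ε`. -/
def psi {d : ℕ} (ε : ℝ) (θ : Matrix (Fin d) (Fin d) ℝ) : Matrix (Fin d) (Fin d) ℝ :=
  Real.exp (-(1 / (2 * ε))) • ∑' n : ℕ, psiTerm ε θ n

/-- `G_ε(α) = e^{-1/(2ε)} (cos α + sin α / (2 ε α))`, extended by continuity to `α = 0`
(`Real.sinc α` is `sin α / α`, with value `1` at `0`). -/
def G (ε α : ℝ) : ℝ :=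
  Real.exp (-(1 / (2 * ε))) * (Real.cos α + Real.sinc α / (2 * ε))

/-- `λ_ε`, the minimum over real `α` of `G_ε(α)`. -/
def lambdaEps (ε : ℝ) : ℝ := ⨅ α : ℝ, G ε α

/-- The real matrix `D` is diagonalizable over `ℂ`. -/
def IsDiagonalizableOverComplex {d : ℕ} (D : Matrix (Fin d) (Fin d) ℝ) : Prop :=
  ∃ (P Q : Matrix (Fin d) (Fin d) ℂ) (w : Fin d → ℂ),
    P * Q = 1 ∧ Q * P = 1 ∧ D.map Complex.ofReal = P * Matrix.diagonal w * Q

/-- The `k × k` Jordan block with eigenvalue `μ`. -/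
def jordanBlock (k : ℕ) (μ : ℂ) : Matrix (Fin k) (Fin k) ℂ :=
  Matrix.of fun i j => if i = j then μ else if (i : ℕ) + 1 = (j : ℕ) then 1 else 0

/-- Over `ℂ`, the real matrix `A` is similar to the block diagonal matrix with blocks
`jordanBlock (size i) (eig i)`, `i < n`, all of positive size. -/
def IsJordanForm {d : ℕ} (A : Matrix (Fin d) (Fin d) ℝ) {n : ℕ} (size : Fin n → ℕ)
    (eig : Fin n → ℂ) : Prop :=
  (∀ i, 0 < size i) ∧
  ∃ (P : Matrix (Fin d) (Σ i : Fin n, Fin (size i)) ℂ)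
    (Q : Matrix (Σ i : Fin n, Fin (size i)) (Fin d) ℂ),
    P * Q = 1 ∧ Q * P = 1 ∧
    A.map Complex.ofReal =
      P * Matrix.blockDiagonal' (fun i => jordanBlock (size i) (eig i)) * Q

/-- In the list of Jordan blocks given by `size` and `eig`, each Jordan block with eigenvalue
`μ` occurs an even number of times: for every `k`, the number of blocks of size `k` with
eigenvalue `μ` is even. -/
def BlocksOccurEvenly {n : ℕ} (size : Fin n → ℕ) (eig : Fin n → ℂ) (μ : ℂ) : Prop :=
  ∀ k : ℕ, Even (Set.ncard {i : Fin n | size i = k ∧ eig i = μ})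

end SecondOrderLinear

end

/-! Write f(w) = Σ `coef ε n` wⁿ, an entire function with f(z²) = e^{-1/(2ε)} (cosh z + sinh z /
(2εz)). The substitution x = e^{-t/(2ε)} y turns the equation into y'' = W y with W = θ/ε +
Id/(4ε²), and the time-one map is f(W). Since θ ↦ W is a bijection, the question is which real
matrices have the form f(W). On the real line f has minimum λ_ε, because f(-α²) = `G ε α` and f
increases on [0, ∞).

Necessity: W commutes with A = f(W), hence preserves ker (A - μ)^k. If this kernel has odd
dimension, W has a real eigenvalue w on it, and then μ = f(w) ≥ λ_ε. So for μ < λ_ε all these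
dimensions are even, and the block counts, being second differences of them, are even too
(`even_kerDim_of_isSeriesImage`).

Sufficiency: split the space into cyclic pieces ℝ[X]/(p^e) and solve f(W) = X in a commutative
algebra acting on a piece, or on a pair of equal pieces. Modulo nilpotents this asks for a preimage
w under f with f'(w) ≠ 0, and Newton's method lifts the solution (`exists_taylorCoeff_zero_eq`). The
analytic input is that f : ℂ → ℂ is surjective, that its critical points are real, and that the real
ones are nondegenerate. A nonreal root of p thus has a regular preimage, and a real l > λ_ε has a
real regular one. For l < λ_ε every preimage is nonreal, so two equal blocks Q² are viewed as Q[i],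
whose residue field is ℂ. At l = λ_ε the preimage on the real line is critical: blocks of size 1 are
scalars and need no lifting, while a pair of larger blocks is viewed as Q[ω] with ω² = X - λ_ε, and
the quadratic Taylor term at the minimum absorbs the square root
(`exists_taylorCoeff_zero_eq_add_sq`). -/

noncomputable section

namespace SecondOrderLinear

/-! ### The entire function f and its Taylor coefficients in normed algebras. -/

section

open Filter Topology

/-- The coefficients of the power series of `Ψ_ε` in the variable `w = θ / ε + 1 / (4 ε²)`. -/
def coef (ε : ℝ) (n : ℕ) : ℝ :=
  Real.exp (-(1 / (2 * ε))) *
    (1 / ((2 * n).factorial : ℝ) + 1 / (2 * ε * ((2 * n + 1).factorial : ℝ)))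

theorem coef_pos {ε : ℝ} (hε : 0 < ε) (n : ℕ) : 0 < coef ε n := by
  unfold coef; positivity

theorem coef_le {ε : ℝ} (hε : 0 < ε) (n : ℕ) :
    coef ε n ≤ Real.exp (-(1 / (2 * ε))) * (1 + 1 / (2 * ε)) / (n.factorial : ℝ) := by
  have h1 : (n.factorial : ℝ) ≤ ((2 * n).factorial : ℝ) := by
    exact_mod_cast Nat.factorial_le (by omega)
  have h2 : (n.factorial : ℝ) ≤ ((2 * n + 1).factorial : ℝ) := by
    exact_mod_cast Nat.factorial_le (by omega)
  have h0 : (0 : ℝ) < n.factorial := by positivity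
  unfold coef
  rw [mul_div_assoc, add_div, div_div]
  gcongr

theorem summable_coef_mul_pow {ε : ℝ} (hε : 0 < ε) {s : ℝ} (hs : 0 ≤ s) :
    Summable fun n => coef ε n * s ^ n := by
  refine Summable.of_nonneg_of_le (fun n => mul_nonneg (coef_pos hε n).le (pow_nonneg hs n))
    (fun n => ?_) ((Real.summable_pow_div_factorial s).mul_left
      (Real.exp (-(1 / (2 * ε))) * (1 + 1 / (2 * ε))))
  calc coef ε n * s ^ n ≤ _ * s ^ n := mul_le_mul_of_nonneg_right (coef_le hε n) (pow_nonneg hs n)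
    _ = _ := by ring

/-- The norm of 1 is not assumed to be 1, as the norms used later are induced from regular
representations and the ring may be trivial. The factor `1 + ‖1‖` covers the exponent 0. -/
theorem norm_pow_le_of_one_le {S : Type*} [NormedRing S] (W : S) {r : ℝ} (hr : 1 ≤ r) (hW : ‖W‖ ≤ r) {m n : ℕ} (hmn : m ≤ n) :
    ‖W ^ m‖ ≤ (1 + ‖(1 : S)‖) * r ^ n := by
  have h1 : ‖W ^ m‖ ≤ (1 + ‖(1 : S)‖) * r ^ m := by
    rcases Nat.eq_zero_or_pos m with rfl | hm
    · simp
    · calc ‖W ^ m‖ ≤ ‖W‖ ^ m := norm_pow_le' _ hm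
        _ ≤ r ^ m := by gcongr
        _ ≤ _ := le_mul_of_one_le_left (by positivity) (by simp)
  exact h1.trans (by gcongr)

section Algebra

variable {S : Type*} [NormedRing S] [NormedAlgebra ℝ S]

/-- The `k`-th Taylor coefficient of `w ↦ ∑ coef ε n w ^ n` at an element `W` of a normed
algebra. -/
def taylorCoeff (ε : ℝ) (k : ℕ) (W : S) : S :=
  ∑' n : ℕ, (coef ε n * (n.choose k : ℝ)) • W ^ (n - k)

theorem norm_taylorCoeff_term_le {ε : ℝ} (hε : 0 < ε) (k n : ℕ) {r : ℝ} (hr : 1 ≤ r) {W : S}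
    (hW : ‖W‖ ≤ r) :
    ‖(coef ε n * (n.choose k : ℝ)) • W ^ (n - k)‖ ≤
      (1 + ‖(1 : S)‖) * (coef ε n * (2 * r) ^ n) := by
  have hc : (n.choose k : ℝ) ≤ 2 ^ n := by exact_mod_cast Nat.choose_le_two_pow n k
  have h0 := (coef_pos hε n).le
  rw [norm_smul, Real.norm_eq_abs, abs_of_nonneg (by positivity), mul_pow]
  calc _ ≤ (coef ε n * 2 ^ n) * ((1 + ‖(1 : S)‖) * r ^ n) := by
        gcongr
        exact norm_pow_le_of_one_le W hr hW (Nat.sub_le _ _)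
    _ = _ := by ring

theorem summable_taylorCoeff_term [CompleteSpace S] {ε : ℝ} (hε : 0 < ε) (k : ℕ) (W : S) :
    Summable fun n : ℕ => (coef ε n * (n.choose k : ℝ)) • W ^ (n - k) := by
  refine Summable.of_norm_bounded (g := fun n => (1 + ‖(1 : S)‖) *
    (coef ε n * (2 * (max 1 ‖W‖)) ^ n)) ((summable_coef_mul_pow hε (by positivity)).mul_left _) ?_
  intro n
  exact norm_taylorCoeff_term_le hε k n (le_max_left _ _) (le_max_right _ _)

theorem hasSum_taylorCoeff [CompleteSpace S] {ε : ℝ} (hε : 0 < ε) (k : ℕ) (W : S) :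
    HasSum (fun n : ℕ => (coef ε n * (n.choose k : ℝ)) • W ^ (n - k)) (taylorCoeff ε k W) :=
  (summable_taylorCoeff_term hε k W).hasSum

theorem hasSum_taylorCoeff_zero [CompleteSpace S] {ε : ℝ} (hε : 0 < ε) (W : S) :
    HasSum (fun n : ℕ => coef ε n • W ^ n) (taylorCoeff ε 0 W) := by
  simpa using hasSum_taylorCoeff hε 0 W

theorem map_taylorCoeff [CompleteSpace S] {T : Type*} [NormedRing T] [NormedAlgebra ℝ T]
    [CompleteSpace T] {ε : ℝ} (hε : 0 < ε) (k : ℕ) (L : S →ₐ[ℝ] T) (hL : Continuous L) (W : S) :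
    L (taylorCoeff ε k W) = taylorCoeff ε k (L W) := by
  have h := (hasSum_taylorCoeff hε k W).map L hL
  refine h.unique ?_
  convert hasSum_taylorCoeff hε k (L W) using 2 with n
  simp

/-- Taylor's formula for an increment that is nilpotent and commutes with the base point. -/
theorem taylorCoeff_zero_add [CompleteSpace S] {ε : ℝ} (hε : 0 < ε) {W s : S} (hWs : Commute W s)
    {m : ℕ} (hs : s ^ m = 0) :
    taylorCoeff ε 0 (W + s) = ∑ k ∈ Finset.range m, taylorCoeff ε k W * s ^ k := by
  have h := hasSum_sum (s := Finset.range m) fun k _ =>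
    (hasSum_taylorCoeff hε k W).mul_right (s ^ k)
  refine (hasSum_taylorCoeff_zero hε (W + s)).unique ?_
  convert! h using 2 with n
  rw [add_comm W s, hWs.symm.add_pow]
  have hz : ∀ k, m ≤ k → s ^ k = 0 := fun k hk => pow_eq_zero_of_le hk hs
  rw [Finset.smul_sum]
  -- Both sums are compared on the larger of their ranges: beyond n the binomial coefficient
  -- vanishes, and from m on the power of s does.
  have e1 : ∑ k ∈ Finset.range (n + 1), coef ε n • (s ^ k * W ^ (n - k) * (n.choose k : S)) =
      ∑ k ∈ Finset.range (max m (n + 1)), (coef ε n * (n.choose k : ℝ)) • W ^ (n - k) * s ^ k := by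
    rw [← Finset.sum_subset (s₁ := Finset.range (n + 1))
      (Finset.range_subset_range.2 (le_max_right _ _))]
    · refine Finset.sum_congr rfl fun k _ => ?_
      rw [smul_mul_assoc, mul_smul, ← (hWs.symm.pow_pow k (n - k)).eq, ← Nat.cast_comm,
        ← nsmul_eq_mul, Nat.cast_smul_eq_nsmul]
    · intro k _ hk
      rw [Nat.choose_eq_zero_of_lt (by simpa using hk)]
      simp
  rw [e1]
  refine (Finset.sum_subset (Finset.range_subset_range.2 (le_max_left _ _)) ?_).symm
  intro k _ hk
  rw [hz k (by simpa using hk), mul_zero]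

end Algebra

/-- Termwise differentiation, justified by the uniform bound on a ball around 0. It identifies
`taylorCoeff ε k` with f^(k)/k!. -/
theorem hasDerivAt_taylorCoeff {𝕜 : Type*} [RCLike 𝕜] {ε : ℝ} (hε : 0 < ε) (k : ℕ) (w : 𝕜) :
    HasDerivAt (taylorCoeff ε k : 𝕜 → 𝕜) (((k : 𝕜) + 1) * taylorCoeff ε (k + 1) w) w := by
  have hb : w ∈ Metric.ball (0 : 𝕜) (‖w‖ + 1) := by simp
  have key : ∀ (n : ℕ) (y : 𝕜), HasDerivAt (fun z : 𝕜 => (coef ε n * (n.choose k : ℝ)) • z ^ (n - k))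
      (((k : 𝕜) + 1) * ((coef ε n * (n.choose (k + 1) : ℝ)) • y ^ (n - (k + 1)))) y := by
    intro n y
    convert! (hasDerivAt_pow (n - k) y).const_smul (coef ε n * (n.choose k : ℝ)) using 1
    have hcc : ((n.choose (k + 1) : ℕ) : 𝕜) * ((k : 𝕜) + 1) = (n.choose k : 𝕜) * ((n - k : ℕ) : 𝕜) := by
      exact_mod_cast Nat.choose_succ_right_eq n k
    rw [show n - k - 1 = n - (k + 1) by omega]
    simp only [RCLike.real_smul_eq_coe_mul, RCLike.ofReal_mul, RCLike.ofReal_natCast]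
    linear_combination (coef ε n : 𝕜) * y ^ (n - (k + 1)) * hcc
  have := hasDerivAt_tsum_of_isPreconnected (𝕜 := 𝕜)
    (u := fun n => ((k : ℝ) + 1) * ((1 + ‖(1 : 𝕜)‖) * (coef ε n * (2 * (‖w‖ + 1)) ^ n)))
    (((summable_coef_mul_pow hε (by positivity)).mul_left _).mul_left _)
    Metric.isOpen_ball (convex_ball (0 : 𝕜) (‖w‖ + 1)).isPreconnected
    (fun n y _ => key n y) (fun n y hy => ?_) hb (summable_taylorCoeff_term hε k w) hb
  · rw [tsum_mul_left] at this
    exact this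
  · rw [norm_mul]
    gcongr
    · exact (norm_add_le _ _).trans (by simp)
    · exact norm_taylorCoeff_term_le hε (k + 1) n (by simp) (by simpa using (mem_ball_zero_iff.1 hy).le)

theorem deriv_taylorCoeff {𝕜 : Type*} [RCLike 𝕜] {ε : ℝ} (hε : 0 < ε) (k : ℕ) :
    deriv (taylorCoeff ε k : 𝕜 → 𝕜) = fun w => ((k : 𝕜) + 1) * taylorCoeff ε (k + 1) w :=
  funext fun w => (hasDerivAt_taylorCoeff hε k w).deriv

theorem ofReal_taylorCoeff {ε : ℝ} (hε : 0 < ε) (k : ℕ) (w : ℝ) :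
    ((taylorCoeff ε k w : ℝ) : ℂ) = taylorCoeff ε k (w : ℂ) :=
  map_taylorCoeff hε k Complex.ofRealAm Complex.continuous_ofReal w

theorem taylorCoeff_algebraMap {S : Type*} [NormedRing S] [NormedAlgebra ℝ S] [CompleteSpace S]
    {ε : ℝ} (hε : 0 < ε) (k : ℕ) (w : ℝ) :
    taylorCoeff ε k (algebraMap ℝ S w) = algebraMap ℝ S (taylorCoeff ε k w) :=
  (map_taylorCoeff hε k (Algebra.ofId ℝ S) (continuous_algebraMap ℝ S) w).symm

/-- The factor z clears the quotient sinh z / z, so that no case distinction at 0 is needed. -/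
theorem mul_taylorCoeff_zero_sq {ε : ℝ} (hε : 0 < ε) (z : ℂ) :
    z * taylorCoeff ε 0 (z ^ 2) =
      Real.exp (-(1 / (2 * ε))) * (z * Complex.cosh z + Complex.sinh z / (2 * ε)) := by
  have h := (hasSum_taylorCoeff_zero hε (z ^ 2)).mul_left z
  have h1 := ((Complex.hasSum_cosh z).mul_left z).add
    ((Complex.hasSum_sinh z).div_const (2 * (ε : ℂ)))
  refine h.unique ?_
  convert h1.mul_left ((Real.exp (-(1 / (2 * ε))) : ℝ) : ℂ) using 2 with n
  have hε' : (ε : ℂ) ≠ 0 := by exact_mod_cast hε.ne'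
  rw [coef, Complex.real_smul]
  push_cast
  rw [← pow_mul, pow_succ]
  field_simp

theorem taylorCoeff_zero_neg_sq {ε : ℝ} (hε : 0 < ε) (α : ℝ) :
    taylorCoeff ε 0 (-α ^ 2) = G ε α := by
  by_cases hα : α = 0
  · subst hα
    have h := hasSum_taylorCoeff_zero hε (-(0 : ℝ) ^ 2)
    rw [h.unique (hasSum_single 0 fun n hn => by simp [hn])]
    simp [coef, G]
  have h := (hasSum_taylorCoeff_zero hε (-α ^ 2)).mul_left α
  have h1 := ((Real.hasSum_cos α).mul_left α).add
    ((Real.hasSum_sin α).div_const (2 * ε))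
  have h2 : α * taylorCoeff ε 0 (-α ^ 2) =
      Real.exp (-(1 / (2 * ε))) * (α * Real.cos α + Real.sin α / (2 * ε)) := by
    refine h.unique ?_
    convert h1.mul_left (Real.exp (-(1 / (2 * ε)))) using 2 with n
    rw [coef, smul_eq_mul, neg_pow, ← pow_mul, pow_succ α]
    field_simp
  rw [G, Real.sinc_of_ne_zero hα]
  have : α * taylorCoeff ε 0 (-α ^ 2) = α * (Real.exp (-(1 / (2 * ε))) *
      (Real.cos α + Real.sin α / α / (2 * ε))) := by
    rw [h2]; field_simp
  exact mul_left_cancel₀ hα this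

theorem taylorCoeff_pos {ε : ℝ} (hε : 0 < ε) (k : ℕ) {w : ℝ} (hw : 0 ≤ w) :
    0 < taylorCoeff ε k w := by
  have hs := summable_taylorCoeff_term hε k w
  have h0 : ∀ n, 0 ≤ (coef ε n * (n.choose k : ℝ)) • w ^ (n - k) := fun n => by
    have := (coef_pos hε n).le
    rw [smul_eq_mul]; positivity
  refine hs.tsum_pos h0 k ?_
  simpa using coef_pos hε k

theorem coef_one_mul_le_taylorCoeff {ε : ℝ} (hε : 0 < ε) {w : ℝ} (hw : 0 ≤ w) :
    coef ε 0 + coef ε 1 * w ≤ taylorCoeff ε 0 w := by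
  have hs := hasSum_taylorCoeff_zero hε w
  have := sum_le_hasSum (Finset.range 2) (fun n _ => by
    have := (coef_pos hε n).le
    rw [smul_eq_mul]; positivity) hs
  simpa [Finset.sum_range_succ] using this

end

/-! ### The real variable: the minimum of f, nondegenerate critical points, regular preimages. -/

section

open Filter Topology

section RealVariable

variable {ε : ℝ}

theorem continuous_G (ε : ℝ) : Continuous (G ε) := by
  unfold G
  have := Real.continuous_sinc
  fun_prop

/-- The derivative of `G ε` away from the origin. -/
def derivG (ε α : ℝ) : ℝ :=
  Real.exp (-(1 / (2 * ε))) *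
    (-Real.sin α + (Real.cos α * α - Real.sin α) / α ^ 2 / (2 * ε))

theorem hasDerivAt_G (ε : ℝ) {α : ℝ} (hα : α ≠ 0) : HasDerivAt (G ε) (derivG ε α) α := by
  have h1 : HasDerivAt (fun x => Real.exp (-(1 / (2 * ε))) *
      (Real.cos x + Real.sin x / x / (2 * ε))) (derivG ε α) α := by
    have := (((Real.hasDerivAt_cos α).add
      (((Real.hasDerivAt_sin α).div (hasDerivAt_id α) hα).div_const (2 * ε))).const_mul
        (Real.exp (-(1 / (2 * ε)))))
    simpa [derivG] using this
  refine h1.congr_of_eventuallyEq ?_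
  filter_upwards [isOpen_ne.mem_nhds hα] with x hx
  rw [G, Real.sinc_of_ne_zero hx]

/-- With κ = e^{-1/(2ε)}, the lower limit of `G ε` at infinity is at least -κ. At π the value is
exactly -κ and the derivative is nonzero, so some value lies strictly below -κ, and the infimum is
attained on a compact set. -/
theorem exists_isMinOn_G (hε : 0 < ε) : ∃ α₀, ∀ α, G ε α₀ ≤ G ε α := by
  have hπ := Real.pi_pos
  set κ := Real.exp (-(1 / (2 * ε))) with hκ
  have hκ0 : 0 < κ := Real.exp_pos _
  have hGπ : G ε Real.pi = -κ := by
    rw [G, Real.sinc_of_ne_zero hπ.ne']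
    simp [hκ]
  obtain ⟨y, hy⟩ : ∃ y, G ε y < G ε Real.pi := by
    by_contra! hcon
    have h0 : IsLocalMin (G ε) Real.pi := Eventually.of_forall hcon
    have h1 := h0.hasDerivAt_eq_zero (hasDerivAt_G ε hπ.ne')
    simp only [derivG, Real.sin_pi, Real.cos_pi, mul_eq_zero, hκ0.ne', ← hκ, false_or] at h1
    have h2 : (-1 * Real.pi - 0) / Real.pi ^ 2 / (2 * ε) < 0 := by
      rw [div_div]
      exact div_neg_of_neg_of_pos (by linarith) (by positivity)
    linarith
  refine (continuous_G ε).exists_forall_le' y ?_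
  have ht : Tendsto (fun x : ℝ => κ * (-1 - ‖x‖⁻¹ / (2 * ε))) (cocompact ℝ)
      (𝓝 (κ * (-1 - 0 / (2 * ε)))) :=
    ((tendsto_const_nhds.sub ((tendsto_inv_atTop_zero.comp
      (tendsto_norm_cocompact_atTop (E := ℝ))).div_const _)).const_mul _)
  have hlt : G ε y < κ * (-1 - 0 / (2 * ε)) := by
    rw [hGπ] at hy; simpa using hy
  filter_upwards [ht.eventually (lt_mem_nhds hlt)] with x hx
  refine hx.le.trans ?_
  rw [G]
  have hs : -‖x‖⁻¹ ≤ Real.sinc x := by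
    by_cases h : x = 0
    · simp [h]
    · rw [Real.sinc_of_ne_zero h, Real.norm_eq_abs]
      have : |Real.sin x / x| ≤ |x|⁻¹ := by
        rw [abs_div, div_eq_mul_inv]
        exact mul_le_of_le_one_left (by positivity) (Real.abs_sin_le_one x)
      exact (abs_le.1 this).1
  refine mul_le_mul_of_nonneg_left ?_ hκ0.le
  have : -‖x‖⁻¹ / (2 * ε) ≤ Real.sinc x / (2 * ε) := by gcongr
  have h2 := Real.neg_one_le_cos x
  rw [neg_div] at this
  linarith

theorem isLeast_lambdaEps (hε : 0 < ε) : IsLeast (Set.range (G ε)) (lambdaEps ε) := by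
  obtain ⟨α₀, h⟩ := exists_isMinOn_G hε
  have hl : IsLeast (Set.range (G ε)) (G ε α₀) := ⟨⟨α₀, rfl⟩, by rintro _ ⟨α, rfl⟩; exact h α⟩
  have : lambdaEps ε = G ε α₀ := hl.csInf_eq
  rwa [this]

theorem lambdaEps_le_taylorCoeff (hε : 0 < ε) (w : ℝ) : lambdaEps ε ≤ taylorCoeff ε 0 w := by
  have hG : ∀ α, lambdaEps ε ≤ G ε α := fun α => (isLeast_lambdaEps hε).2 ⟨α, rfl⟩
  rcases le_or_gt 0 w with hw | hw
  · refine (hG 0).trans ?_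
    have h0 := taylorCoeff_zero_neg_sq hε 0
    have h1 := coef_one_mul_le_taylorCoeff hε hw
    have h2 : taylorCoeff ε 0 (-(0 : ℝ) ^ 2) = coef ε 0 := by
      rw [(hasSum_taylorCoeff_zero hε (-(0 : ℝ) ^ 2)).unique
        (hasSum_single 0 fun n hn => by simp [hn])]
      simp
    rw [← h0, h2]
    have := coef_pos hε 1
    nlinarith
  · have : w = -(√(-w)) ^ 2 := by rw [Real.sq_sqrt (by linarith)]; ring
    rw [this, taylorCoeff_zero_neg_sq hε]
    exact hG _

theorem exists_taylorCoeff_eq_lambdaEps (hε : 0 < ε) :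
    ∃ w : ℝ, taylorCoeff ε 0 w = lambdaEps ε := by
  obtain ⟨α, hα⟩ := (isLeast_lambdaEps hε).1
  exact ⟨-α ^ 2, by rw [taylorCoeff_zero_neg_sq hε, hα]⟩

theorem hasDerivAt_derivG (ε : ℝ) {α : ℝ} (hα : α ≠ 0) :
    HasDerivAt (derivG ε) (Real.exp (-(1 / (2 * ε))) *
      (-Real.cos α + (-Real.sin α / α - 2 * Real.cos α / α ^ 2 + 2 * Real.sin α / α ^ 3) /
        (2 * ε))) α := by
  have h := (((Real.hasDerivAt_sin α).neg.add
    (((((Real.hasDerivAt_cos α).mul (hasDerivAt_id α)).sub (Real.hasDerivAt_sin α)).div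
      (hasDerivAt_pow 2 α) (pow_ne_zero 2 hα)).div_const (2 * ε))).const_mul
        (Real.exp (-(1 / (2 * ε)))))
  convert! h using 1
  congr 2
  simp only [id]
  field_simp
  simp
  ring

theorem derivG_eq (hε : 0 < ε) {α : ℝ} (hα : α ≠ 0) :
    derivG ε α = -(2 * α) * taylorCoeff ε 1 (-α ^ 2) := by
  have h1 : HasDerivAt (fun x : ℝ => taylorCoeff ε 0 (-x ^ 2))
      (taylorCoeff ε 1 (-α ^ 2) * (-(2 * α))) α := by
    have := (hasDerivAt_taylorCoeff hε 0 (-α ^ 2)).comp α (hasDerivAt_pow 2 α).neg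
    convert! this using 1
    simp
  rw [show (fun x : ℝ => taylorCoeff ε 0 (-x ^ 2)) = G ε from
    funext (taylorCoeff_zero_neg_sq hε)] at h1
  rw [(hasDerivAt_G ε hα).unique h1]; ring

/-- A critical point is negative, w = -α². If it were degenerate, the first two derivatives of `G ε`
would vanish at α, giving two linear equations in cos α and sin α whose only solution is (0, 0). -/
theorem taylorCoeff_two_ne_zero (hε : 0 < ε) {w : ℝ} (h1 : taylorCoeff ε 1 w = 0) :
    taylorCoeff ε 2 w ≠ 0 := by
  intro h2
  have hw : w < 0 := by
    by_contra! h
    exact (taylorCoeff_pos hε 1 h).ne' h1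
  obtain ⟨α, hα, rfl⟩ : ∃ α : ℝ, 0 < α ∧ w = -α ^ 2 :=
    ⟨√(-w), Real.sqrt_pos.2 (by linarith), by rw [Real.sq_sqrt (by linarith)]; ring⟩
  have hd : HasDerivAt (fun x : ℝ => -(2 * x) * taylorCoeff ε 1 (-x ^ 2)) 0 α := by
    have e1 := (hasDerivAt_taylorCoeff hε 1 (-α ^ 2)).comp α (hasDerivAt_pow 2 α).neg
    have e2 := ((hasDerivAt_id α).const_mul (2 : ℝ)).neg.mul e1
    convert! e2 using 1
    simp [h1, h2]
  have hd' := (hasDerivAt_derivG ε hα.ne').unique (hd.congr_of_eventuallyEq (by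
    filter_upwards [isOpen_ne.mem_nhds hα.ne'] with x hx
    exact derivG_eq hε hx))
  have hd1 : derivG ε α = 0 := by rw [derivG_eq hε hα.ne', h1, mul_zero]
  have hκ : Real.exp (-(1 / (2 * ε))) ≠ 0 := (Real.exp_pos _).ne'
  simp only [derivG, mul_eq_zero, hκ, false_or] at hd1 hd'
  have hsc := Real.sin_sq_add_cos_sq α
  set p := Real.cos α
  set q := Real.sin α
  field_simp at hd1 hd'
  have hp : p * α = q * (1 + 2 * ε * α ^ 2) := by linarith
  -- Eliminating cos α leaves sin α times a positive quantity.
  have hq : q * (α ^ 2 * (2 * ε) * (1 + 2 * ε * α ^ 2) + α ^ 2 + 4 * ε * α ^ 2) = 0 := by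
    linear_combination (-1 : ℝ) * hd' - (α ^ 2 * (2 * ε) + 2) * hp
  have hq0 : q = 0 := by
    rcases mul_eq_zero.1 hq with h | h
    · exact h
    · have : 0 < α ^ 2 * (2 * ε) * (1 + 2 * ε * α ^ 2) + α ^ 2 + 4 * ε * α ^ 2 := by positivity
      linarith
  have hp0 : p = 0 := by
    rw [hq0, zero_mul] at hp
    exact (mul_eq_zero.1 hp).resolve_right hα.ne'
  rw [hp0, hq0] at hsc
  norm_num at hsc

end RealVariable

/-- The strict form of the second derivative test. -/
theorem eventually_lt_of_deriv_deriv_pos {f : ℝ → ℝ} {x₀ : ℝ} (hf : 0 < deriv (deriv f) x₀)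
    (hd : deriv f x₀ = 0) (hdiff : Differentiable ℝ f) (hdiff' : DifferentiableAt ℝ (deriv f) x₀) :
    ∀ᶠ x in 𝓝[≠] x₀, f x₀ < f x := by
  -- Subtracting δ (x - x₀)² only halves the second derivative at x₀, so the non-strict test still
  -- applies and leaves a strictly positive margin.
  set δ := deriv (deriv f) x₀ / 4 with hδ
  set g : ℝ → ℝ := fun x => f x - δ * (x - x₀) ^ 2 with hg
  have hg1 : ∀ x, HasDerivAt g (deriv f x - 2 * δ * (x - x₀)) x := fun x => by
    have := (hdiff x).hasDerivAt.sub ((((hasDerivAt_id x).sub_const x₀).pow 2).const_mul δ)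
    convert! this using 1
    simp; ring
  have hg1' : deriv g = fun x => deriv f x - 2 * δ * (x - x₀) := funext fun x => (hg1 x).deriv
  have hg2 : HasDerivAt (deriv g) (deriv (deriv f) x₀ - 2 * δ) x₀ := by
    rw [hg1']
    have := hdiff'.hasDerivAt.sub (((hasDerivAt_id x₀).sub_const x₀).const_mul (2 * δ))
    convert! this using 1
    simp
  have hmin : IsLocalMin g x₀ := isLocalMin_of_deriv_deriv_pos
    (by rw [hg2.deriv, hδ]; linarith) (by rw [hg1']; simp [hd]) (hg1 x₀).continuousAt
  filter_upwards [hmin.filter_mono nhdsWithin_le_nhds, self_mem_nhdsWithin] with x hx hne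
  have h3 : 0 < δ * (x - x₀) ^ 2 := by
    have : x - x₀ ≠ 0 := sub_ne_zero.2 hne
    positivity
  simp only [hg, sub_self, ne_eq, OfNat.ofNat_ne_zero, not_false_eq_true, zero_pow, mul_zero,
    sub_zero] at hx
  linarith

/-- A function whose critical points are nondegenerate takes every value strictly between two of
its values at a noncritical point. -/
theorem exists_eq_and_deriv_ne_zero {f : ℝ → ℝ} (hdiff : Differentiable ℝ f)
    (hdiff' : Differentiable ℝ (deriv f)) (hcrit : ∀ x, deriv f x = 0 → deriv (deriv f) x ≠ 0)
    {a b y : ℝ} (hab : a ≤ b) (ha : f a < y) (hb : y < f b) :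
    ∃ x, f x = y ∧ deriv f x ≠ 0 := by
  -- The supremum of this set is a crossing point: f ≥ y immediately to its right, while points with
  -- f < y accumulate at it.
  set T := {x | x ∈ Set.Icc a b ∧ f x < y} with hT
  have hTne : T.Nonempty := ⟨a, ⟨le_rfl, hab⟩, ha⟩
  have hTbdd : BddAbove T := ⟨b, fun x hx => hx.1.2⟩
  set x₀ := sSup T with hx₀
  have hax : a ≤ x₀ := le_csSup hTbdd ⟨⟨le_rfl, hab⟩, ha⟩
  have hxb : x₀ ≤ b := csSup_le hTne fun x hx => hx.1.2
  have hcl : x₀ ∈ closure T := csSup_mem_closure hTne hTbdd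
  have hle : f x₀ ≤ y :=
    closure_minimal (fun x hx => hx.2.le) (isClosed_le hdiff.continuous continuous_const) hcl
  have hxb' : x₀ < b := lt_of_le_of_ne hxb fun h => by rw [h] at hle; linarith
  have hright : ∀ x ∈ Set.Ioc x₀ b, y ≤ f x := fun x hx => by
    by_contra! h
    exact absurd (le_csSup hTbdd ⟨⟨hax.trans hx.1.le, hx.2⟩, h⟩) (not_le.2 hx.1)
  have hIoc : Set.Ioc x₀ b ∈ 𝓝[>] x₀ := Ioc_mem_nhdsGT hxb'
  have hge : y ≤ f x₀ := by
    refine ge_of_tendsto (hdiff.continuous.continuousAt.mono_left nhdsWithin_le_nhds :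
      Tendsto f (𝓝[>] x₀) (𝓝 (f x₀))) ?_
    filter_upwards [hIoc] with x hx using hright x hx
  have heq : f x₀ = y := le_antisymm hle hge
  refine ⟨x₀, heq, fun h0 => ?_⟩
  -- A critical x₀ would be a strict local maximum, contradicting f ≥ y on the right, or a strict
  -- local minimum, contradicting the accumulation of `T`.
  rcases lt_or_gt_of_ne (hcrit x₀ h0) with hneg | hpos
  · have := eventually_lt_of_deriv_deriv_pos (f := fun x => -f x) (x₀ := x₀)
      (by simpa using hneg) (by simpa using h0) hdiff.neg (by
        have : deriv (fun x => -f x) = fun x => -deriv f x := by ext x; simp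
        rw [this]; exact (hdiff' x₀).neg)
    have h1 : ∀ᶠ x in 𝓝[>] x₀, -f x₀ < -f x ∧ x ∈ Set.Ioc x₀ b := (this.filter_mono (nhdsWithin_mono x₀ (fun x (hx : x₀ < x) => hx.ne'))).and hIoc
    obtain ⟨x, hx, hx'⟩ := h1.exists
    have := hright x hx'
    linarith
  · have := eventually_lt_of_deriv_deriv_pos hpos h0 hdiff (hdiff' x₀)
    rw [eventually_nhdsWithin_iff] at this
    obtain ⟨x, hx, hxT⟩ := mem_closure_iff_nhds.1 hcl _ this
    have hne : x ≠ x₀ := fun h => by rw [h] at hxT; linarith [hxT.2]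
    have := hx hne
    linarith [hxT.2]

section RealVariable

variable {ε : ℝ}

theorem deriv_taylorCoeff_zero (hε : 0 < ε) :
    deriv (taylorCoeff ε 0 : ℝ → ℝ) = taylorCoeff ε 1 := by
  rw [deriv_taylorCoeff hε]; simp

theorem deriv_taylorCoeff_one (hε : 0 < ε) :
    deriv (taylorCoeff ε 1 : ℝ → ℝ) = fun w => 2 * taylorCoeff ε 2 w := by
  rw [deriv_taylorCoeff hε]; norm_num

theorem differentiable_taylorCoeff {𝕜 : Type*} [RCLike 𝕜] (hε : 0 < ε) (k : ℕ) :
    Differentiable 𝕜 (taylorCoeff ε k : 𝕜 → 𝕜) :=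
  fun w => (hasDerivAt_taylorCoeff hε k w).differentiableAt

theorem exists_regular_preimage (hε : 0 < ε) {y : ℝ} (hy : lambdaEps ε < y) :
    ∃ w : ℝ, taylorCoeff ε 0 w = y ∧ taylorCoeff ε 1 w ≠ 0 := by
  obtain ⟨a, ha⟩ := exists_taylorCoeff_eq_lambdaEps hε
  have hc := coef_pos hε 1
  -- The linear lower bound for f on [0, ∞) makes f b ≥ y + 1.
  set b := max (max 0 a) ((y + 1 - coef ε 0) / coef ε 1) with hb
  have hb1 := coef_one_mul_le_taylorCoeff hε (w := b) (by simp [hb])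
  have hb2 : y + 1 - coef ε 0 ≤ coef ε 1 * b := by
    rw [← div_le_iff₀' hc]; exact le_max_right _ _
  obtain ⟨w, h1, h2⟩ := exists_eq_and_deriv_ne_zero (f := taylorCoeff ε 0) (a := a) (b := b) (y := y)
    (differentiable_taylorCoeff hε 0)
    (by rw [deriv_taylorCoeff_zero hε]; exact differentiable_taylorCoeff hε 1)
    (by
      rw [deriv_taylorCoeff_zero hε, deriv_taylorCoeff_one hε]
      intro x hx
      exact mul_ne_zero two_ne_zero (taylorCoeff_two_ne_zero hε hx))
    ((le_max_right _ _).trans (le_max_left _ _)) (by rw [ha]; exact hy) (by linarith)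
  exact ⟨w, h1, by rwa [deriv_taylorCoeff_zero hε] at h2⟩

theorem exists_minimum_point (hε : 0 < ε) : ∃ w : ℝ, taylorCoeff ε 0 w = lambdaEps ε ∧
    taylorCoeff ε 1 w = 0 ∧ 0 < taylorCoeff ε 2 w := by
  obtain ⟨a, ha⟩ := exists_taylorCoeff_eq_lambdaEps hε
  have hmin : ∀ x : ℝ, taylorCoeff ε 0 a ≤ taylorCoeff ε 0 x := fun x => by
    rw [ha]; exact lambdaEps_le_taylorCoeff hε x
  have h1 : taylorCoeff ε 1 a = 0 := by
    have : IsLocalMin (taylorCoeff ε 0 : ℝ → ℝ) a := Eventually.of_forall hmin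
    have := this.deriv_eq_zero
    rwa [deriv_taylorCoeff_zero hε] at this
  refine ⟨a, ha, h1, ?_⟩
  by_contra! hle
  have hlt := lt_of_le_of_ne hle (taylorCoeff_two_ne_zero hε h1)
  have hderiv : deriv (fun x : ℝ => -taylorCoeff ε 0 x) = fun x => -taylorCoeff ε 1 x := by
    ext x; simp [deriv_taylorCoeff_zero hε]
  have := eventually_lt_of_deriv_deriv_pos (f := fun x : ℝ => -taylorCoeff ε 0 x) (x₀ := a)
    (by
      rw [hderiv]
      simp only [deriv.fun_neg, deriv_taylorCoeff_one hε]
      linarith)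
    (by rw [hderiv]; simp [h1]) (differentiable_taylorCoeff hε 0).neg
    (by rw [hderiv]; exact (differentiable_taylorCoeff hε 1).neg a)
  obtain ⟨x, hx⟩ := this.exists
  linarith [hmin x]

end RealVariable

end

/-! ### The complex variable: surjectivity of f and location of its critical points. -/

section

open Filter Topology

section ComplexVariable

variable {ε : ℝ}

theorem norm_sinh_le (z : ℂ) : ‖Complex.sinh z‖ ≤ ‖Complex.cosh z‖ + 1 := by
  have h : ‖Complex.sinh z‖ ^ 2 ≤ ‖Complex.cosh z‖ ^ 2 + 1 := by
    rw [← norm_pow, ← norm_pow, Complex.sinh_sq]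
    exact (norm_sub_le _ _).trans (by simp)
  have := norm_nonneg (Complex.cosh z)
  exact le_of_sq_le_sq (by nlinarith) (by linarith)

theorem cosh_re_im (z : ℂ) : (Complex.cosh z).re = Real.cosh z.re * Real.cos z.im ∧
    (Complex.cosh z).im = Real.sinh z.re * Real.sin z.im := by
  conv => congr <;> rw [← Complex.re_add_im z]
  rw [Complex.cosh_add, Complex.cosh_mul_I, Complex.sinh_mul_I]
  simp [Complex.cos_ofReal_re, Complex.sin_ofReal_re, Complex.sinh_ofReal_re]

theorem sinh_re_im (z : ℂ) : (Complex.sinh z).re = Real.sinh z.re * Real.cos z.im ∧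
    (Complex.sinh z).im = Real.cosh z.re * Real.sin z.im := by
  conv => congr <;> rw [← Complex.re_add_im z]
  rw [Complex.sinh_add, Complex.cosh_mul_I, Complex.sinh_mul_I]
  simp [Complex.cos_ofReal_re, Complex.sin_ofReal_re, Complex.sinh_ofReal_re]

theorem abs_sinh_re_le_norm_cosh (z : ℂ) : |Real.sinh z.re| ≤ ‖Complex.cosh z‖ := by
  rw [← abs_of_nonneg (norm_nonneg (Complex.cosh z)), ← sq_le_sq, ← Complex.normSq_eq_norm_sq,
    Complex.normSq_apply, (cosh_re_im z).1, (cosh_re_im z).2]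
  have h1 := Real.cosh_sq z.re
  have h2 := Real.sin_sq_add_cos_sq z.im
  have h3 := sq_nonneg (Real.cos z.im)
  have : Real.cosh z.re * Real.cos z.im * (Real.cosh z.re * Real.cos z.im) +
      Real.sinh z.re * Real.sin z.im * (Real.sinh z.re * Real.sin z.im) =
      Real.sinh z.re ^ 2 + Real.cos z.im ^ 2 := by
    linear_combination Real.cos z.im ^ 2 * h1 + Real.sinh z.re ^ 2 * h2
  linarith

/-- On a suitable periodic family of horizontal lines, `cosh` stays away from a given value. -/
theorem exists_horizontal_lines (μ : ℂ) : ∃ θ δ : ℝ, 0 ≤ θ ∧ 0 < δ ∧ ∀ (n : ℕ) (z : ℂ),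
    |z.im| = θ + n * Real.pi → δ ≤ ‖Complex.cosh z - μ‖ := by
  -- The real part of cosh z is cosh x cos y. It has modulus at least 1 on the lines y ∈ πℤ, which
  -- serve when Re μ = 0, and it vanishes on y ∈ π/2 + πℤ, which serve otherwise.
  by_cases hμ : μ.re = 0
  · refine ⟨0, 1, le_rfl, one_pos, fun n z hz => ?_⟩
    refine le_trans ?_ (Complex.abs_re_le_norm _)
    have hc : |Real.cos z.im| = 1 := by
      rw [← Real.cos_abs, hz, zero_add]
      exact_mod_cast Real.abs_cos_int_mul_pi n
    rw [Complex.sub_re, hμ, sub_zero, (cosh_re_im z).1, abs_mul, hc, mul_one]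
    exact (Real.one_le_cosh _).trans (le_abs_self _)
  · refine ⟨Real.pi / 2, |μ.re|, by positivity, by positivity, fun n z hz => ?_⟩
    refine le_trans ?_ (Complex.abs_re_le_norm _)
    have hc : Real.cos z.im = 0 := by
      rw [← Real.cos_abs, hz, Real.cos_eq_zero_iff]
      exact ⟨n, by push_cast; ring⟩
    rw [Complex.sub_re, (cosh_re_im z).1, hc, mul_zero, zero_sub, abs_neg]

/-- The entire function `∑ coef ε n w ^ n` takes every complex value. -/
theorem taylorCoeff_zero_surjective (hε : 0 < ε) (y : ℂ) : ∃ w : ℂ, taylorCoeff ε 0 w = y := by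
  -- If y is omitted, 1/(f(z²) - y) is entire. It is bounded by one constant on the boundaries of
  -- arbitrarily large rectangles, hence everywhere by the maximum principle, hence constant by
  -- Liouville; but f(0) < f(1).
  by_contra! hne
  set κ : ℝ := Real.exp (-(1 / (2 * ε))) with hκ
  have hκ0 : 0 < κ := Real.exp_pos _
  set μ : ℂ := y / κ with hμ
  set c : ℝ := 1 / (2 * ε) with hc
  have hc0 : 0 < c := by positivity
  obtain ⟨θ, δ, hθ, hδ, hline⟩ := exists_horizontal_lines μ
  set m := ‖μ‖ with hm
  have hm0 : 0 ≤ m := norm_nonneg _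
  -- This makes ρ (|cosh z| + 1) ≤ |cosh z - μ|: the bound 1/2 serves for |cosh z| ≥ 2m + 1, the
  -- other one for smaller values. For |z| ≥ 2c/ρ the term c sinh z / z consumes at most half of it.
  set ρ := min (1 / 2) (δ / (2 * m + 2)) with hρ
  have hρ0 : 0 < ρ := by positivity
  have hlow : ∀ z : ℂ, δ ≤ ‖Complex.cosh z - μ‖ → 2 * c / ρ ≤ ‖z‖ →
      κ * (ρ / 2) ≤ ‖taylorCoeff ε 0 (z ^ 2) - y‖ := by
    intro z hz hzc
    have hzpos : 0 < ‖z‖ := lt_of_lt_of_le (by positivity) hzc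
    have hz0 : z ≠ 0 := norm_pos_iff.1 hzpos
    have hid : taylorCoeff ε 0 (z ^ 2) - y =
        κ * ((Complex.cosh z - μ) + c * Complex.sinh z / z) := by
      have h : z * taylorCoeff ε 0 (z ^ 2) =
          κ * (z * Complex.cosh z + Complex.sinh z / (2 * ε)) := mul_taylorCoeff_zero_sq hε z
      have hκ' : (κ : ℂ) ≠ 0 := by exact_mod_cast hκ0.ne'
      have hε' : (ε : ℂ) ≠ 0 := by exact_mod_cast hε.ne'
      refine mul_left_cancel₀ hz0 ?_
      rw [mul_sub, h, hμ, hc]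
      push_cast
      field_simp
      ring
    rw [hid, norm_mul, Complex.norm_real, Real.norm_of_nonneg hκ0.le]
    refine mul_le_mul_of_nonneg_left ?_ hκ0.le
    set a := ‖Complex.cosh z‖ with ha
    have ha0 : 0 ≤ a := norm_nonneg _
    have h1 : ρ * (a + 1) ≤ ‖Complex.cosh z - μ‖ := by
      rcases le_or_gt (2 * m + 1) a with h | h
      · have h2 : a - m ≤ ‖Complex.cosh z - μ‖ := norm_sub_norm_le _ _
        have h3 : ρ * (a + 1) ≤ 1 / 2 * (a + 1) := by
          gcongr; exact min_le_left _ _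
        linarith
      · refine le_trans ?_ hz
        calc ρ * (a + 1) ≤ δ / (2 * m + 2) * (2 * m + 2) := by
              exact mul_le_mul (min_le_right _ _) (by linarith) (by linarith) (by positivity)
          _ = δ := by field_simp
    have h2 : ‖(c : ℂ) * Complex.sinh z / z‖ ≤ ρ / 2 * (a + 1) := by
      rw [norm_div, norm_mul, Complex.norm_real, Real.norm_of_nonneg hc0.le, div_le_iff₀ hzpos]
      have h4 : c ≤ ρ / 2 * ‖z‖ := by
        rw [div_le_iff₀ hρ0] at hzc; linarith
      calc c * ‖Complex.sinh z‖ ≤ (ρ / 2 * ‖z‖) * (a + 1) := by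
            gcongr; exact norm_sinh_le z
        _ = _ := by ring
    have h3 := norm_sub_le ((Complex.cosh z - μ) + c * Complex.sinh z / z) (c * Complex.sinh z / z)
    rw [add_sub_cancel_right] at h3
    nlinarith
  set g : ℂ → ℂ := fun z => (taylorCoeff ε 0 (z ^ 2) - y)⁻¹ with hg
  have hgd : Differentiable ℂ g := by
    intro z
    have h1 : DifferentiableAt ℂ (fun z : ℂ => taylorCoeff ε 0 (z ^ 2)) z :=
      ((differentiable_taylorCoeff hε 0) (z ^ 2)).comp z (differentiableAt_pow 2)
    exact (h1.sub_const y).inv (sub_ne_zero.2 (hne _))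
  have hgb : ∀ z, ‖g z‖ ≤ (κ * (ρ / 2))⁻¹ := by
    intro z₀
    obtain ⟨N, hN⟩ := exists_nat_gt (max |z₀.im| (2 * c / ρ) / Real.pi)
    rw [div_lt_iff₀ Real.pi_pos] at hN
    set Y := θ + N * Real.pi with hY
    have hY1 : |z₀.im| < Y := lt_of_le_of_lt (le_max_left _ _) (hN.trans_le (by linarith))
    have hY2 : 2 * c / ρ ≤ Y := (le_max_right _ _).trans (hN.le.trans (by linarith))
    -- On the vertical sides |cosh z| ≥ sinh R ≥ R ≥ δ + m, so cosh z again keeps distance δ from μ.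
    set R := max (|z₀.re| + 1) (max (2 * c / ρ) (δ + m)) with hR
    have hR1 : |z₀.re| < R := lt_of_lt_of_le (by linarith) (le_max_left _ _)
    have hR2 : 2 * c / ρ ≤ R := (le_max_left _ _).trans (le_max_right _ _)
    have hR3 : δ + m ≤ R := (le_max_right _ _).trans (le_max_right _ _)
    set U : Set ℂ := Set.Ioo (-R) R ×ℂ Set.Ioo (-Y) Y with hU
    have hR0 : -R < R := by linarith [abs_nonneg z₀.re]
    have hY0 : -Y < Y := by linarith [abs_nonneg z₀.im]
    have hz₀ : z₀ ∈ U := ⟨abs_lt.1 hR1, abs_lt.1 hY1⟩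
    refine Complex.norm_le_of_forall_mem_frontier_norm_le (U := U)
      ((Metric.isBounded_Ioo _ _).reProdIm (Metric.isBounded_Ioo _ _)) hgd.diffContOnCl ?_
      (subset_closure hz₀)
    intro z hz
    have hUo : IsOpen U := isOpen_Ioo.reProdIm isOpen_Ioo
    rw [hUo.frontier_eq, hU, Complex.closure_reProdIm, closure_Ioo hR0.ne, closure_Ioo hY0.ne] at hz
    obtain ⟨⟨hz1, hz2⟩, hz3⟩ := hz
    have hb1 : |z.re| ≤ R := abs_le.2 ⟨hz1.1, hz1.2⟩
    have hb2 : |z.im| ≤ Y := abs_le.2 ⟨hz2.1, hz2.2⟩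
    rw [hg]
    simp only [norm_inv]
    refine inv_anti₀ (by positivity) ?_
    by_cases him : |z.im| = Y
    · exact hlow z (hline N z him) (hY2.trans (him ▸ Complex.abs_im_le_norm z))
    · have hre : |z.re| = R := by
        refine le_antisymm hb1 (not_lt.1 fun h => hz3 ⟨abs_lt.1 h, abs_lt.1 (lt_of_le_of_ne hb2 him)⟩)
      refine hlow z ?_ (hR2.trans (hre ▸ Complex.abs_re_le_norm z))
      have h1 := abs_sinh_re_le_norm_cosh z
      rw [Real.abs_sinh, hre] at h1
      have h2 : R ≤ Real.sinh R := Real.self_le_sinh_iff.2 (by linarith [abs_nonneg z₀.re])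
      have h3 : ‖Complex.cosh z‖ - m ≤ ‖Complex.cosh z - μ‖ := norm_sub_norm_le _ _
      linarith
  have hconst := hgd.apply_eq_apply_of_bounded
    (isBounded_iff_forall_norm_le.2 ⟨_, by rintro _ ⟨z, rfl⟩; exact hgb z⟩) 0 1
  have h1 : taylorCoeff ε 0 (((0 : ℝ) ^ 2 : ℝ) : ℂ) = taylorCoeff ε 0 (((1 : ℝ) ^ 2 : ℝ) : ℂ) := by
    have := inv_injective hconst
    simpa using this
  rw [← ofReal_taylorCoeff hε, ← ofReal_taylorCoeff hε, Complex.ofReal_inj] at h1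
  have h2 := coef_one_mul_le_taylorCoeff hε (w := (1 : ℝ) ^ 2) (by norm_num)
  have h3 : taylorCoeff ε 0 ((0 : ℝ) ^ 2) = coef ε 0 := by
    rw [(hasSum_taylorCoeff_zero hε ((0 : ℝ) ^ 2)).unique
      (hasSum_single 0 fun n hn => by simp [hn])]
    simp
  have := coef_pos hε 1
  norm_num at h1 h2 h3
  linarith

/-- The critical points of the entire function `∑ coef ε n w ^ n` are real. -/
theorem taylorCoeff_one_ne_zero (hε : 0 < ε) {w : ℂ} (hw : w.im ≠ 0) : taylorCoeff ε 1 w ≠ 0 := by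
  intro h1
  obtain ⟨z, rfl⟩ : ∃ z : ℂ, z ^ 2 = w := IsAlgClosed.exists_pow_nat_eq w two_pos
  have hxy : z.re ≠ 0 ∧ z.im ≠ 0 := by
    constructor <;> rintro h <;> apply hw <;> simp [sq, h]
  -- At a zero of f'(z²) the product rule loses its second term. Comparison with the derivative of
  -- the closed form yields a relation between sinh z and cosh z alone.
  have hd : HasDerivAt (fun z : ℂ => z * taylorCoeff ε 0 (z ^ 2)) (taylorCoeff ε 0 (z ^ 2)) z := by
    have := (hasDerivAt_id z).mul ((hasDerivAt_taylorCoeff hε 0 (z ^ 2)).comp z (hasDerivAt_pow 2 z))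
    convert! this using 1
    simp [h1]
  have hd' : HasDerivAt (fun z : ℂ => z * taylorCoeff ε 0 (z ^ 2))
      (Real.exp (-(1 / (2 * ε))) * (1 * Complex.cosh z + z * Complex.sinh z +
        Complex.cosh z / (2 * ε))) z := by
    rw [funext (mul_taylorCoeff_zero_sq hε)]
    exact (((hasDerivAt_id z).mul (Complex.hasDerivAt_cosh z)).add
      ((Complex.hasDerivAt_sinh z).div_const _)).const_mul _
  have h := hd.unique hd'
  have h2 := mul_taylorCoeff_zero_sq hε z
  rw [h] at h2
  have hκ : ((Real.exp (-(1 / (2 * ε))) : ℝ) : ℂ) ≠ 0 := by exact_mod_cast (Real.exp_pos _).ne'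
  rw [mul_left_comm] at h2
  have h3 := mul_left_cancel₀ hκ h2
  have hε' : (ε : ℂ) ≠ 0 := by exact_mod_cast hε.ne'
  field_simp at h3
  have h4 : (2 * ε * z ^ 2 - 1) * Complex.sinh z + z * Complex.cosh z = 0 := by
    linear_combination h3
  obtain ⟨x, y, rfl⟩ : ∃ x y : ℝ, z = ⟨x, y⟩ := ⟨z.re, z.im, rfl⟩
  obtain ⟨hx, hy⟩ := hxy
  simp only at hx hy
  have hre := congrArg Complex.re h4
  have him := congrArg Complex.im h4
  simp only [Complex.add_re, Complex.mul_re, Complex.sub_re, Complex.add_im, Complex.mul_im,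
    Complex.sub_im, (cosh_re_im _).1, (cosh_re_im _).2, (sinh_re_im _).1, (sinh_re_im _).2,
    Complex.ofReal_re, Complex.ofReal_im, sq, Complex.one_re, Complex.one_im, Complex.re_ofNat,
    Complex.im_ofNat, Complex.zero_re, Complex.zero_im] at hre him
  have hC2 := Real.cosh_sq x
  have hpq := Real.sin_sq_add_cos_sq y
  have hsx : x ^ 2 ≤ x * (Real.sinh x * Real.cosh x) := by
    have hC := Real.one_le_cosh x
    rcases le_total 0 x with h0 | h0
    · have := Real.self_le_sinh_iff.2 h0
      nlinarith [mul_nonneg h0 (this.trans' h0)]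
    · have := Real.sinh_le_self_iff.2 h0
      nlinarith [mul_nonneg (neg_nonneg.2 h0) (neg_nonneg.2 (this.trans h0))]
  have hsy : y * (Real.cos y * Real.sin y) ≤ y ^ 2 := by
    have h5 := Real.abs_sin_le_abs (x := y)
    have h6 := Real.abs_cos_le_one y
    calc y * (Real.cos y * Real.sin y) ≤ |y * (Real.cos y * Real.sin y)| := le_abs_self _
      _ = |y| * (|Real.cos y| * |Real.sin y|) := by rw [abs_mul, abs_mul]
      _ ≤ |y| * (1 * |y|) := by gcongr
      _ = y ^ 2 := by rw [one_mul, ← sq, sq_abs]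
  have hs0 : Real.sinh x ≠ 0 := Real.sinh_eq_zero.not.2 hx
  set s := Real.sinh x
  set C := Real.cosh x
  set p := Real.cos y
  set q := Real.sin y
  set M := s ^ 2 + q ^ 2 with hM
  have hM0 : 0 < M := by positivity
  set r := x ^ 2 + y ^ 2 with hr
  have hr0 : 0 < r := by positivity
  -- `e1` and `e2` are the real and imaginary parts of the relation `h4` multiplied by the conjugate
  -- of z sinh z; here M = |sinh z|² and r = |z|².
  have e1 : x * (2 * ε * r - 1) * M + r * (s * C) = 0 := by
    linear_combination (x * s * p - y * C * q) * hre + (x * C * q + y * s * p) * him -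
      (x * (2 * ε * r - 1) * s ^ 2 + r * s * C) * hpq - x * (2 * ε * r - 1) * q ^ 2 * hC2
  have e2 : y * (2 * ε * r + 1) * M - r * (p * q) = 0 := by
    linear_combination (x * s * p - y * C * q) * him - (x * C * q + y * s * p) * hre -
      y * (2 * ε * r + 1) * s ^ 2 * hpq - (y * (2 * ε * r + 1) * q ^ 2 - r * p * q) * hC2
  have f1 : x ^ 2 * ((2 * ε * r - 1) * M + r) ≤ 0 := by
    have : x ^ 2 * ((2 * ε * r - 1) * M + r) = r * (x ^ 2 - x * (s * C)) := by
      linear_combination x * e1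
    rw [this]
    exact mul_nonpos_of_nonneg_of_nonpos hr0.le (by linarith)
  have f2 : y ^ 2 * ((2 * ε * r + 1) * M - r) ≤ 0 := by
    have : y ^ 2 * ((2 * ε * r + 1) * M - r) = r * (y * (p * q) - y ^ 2) := by
      linear_combination y * e2
    rw [this]
    exact mul_nonpos_of_nonneg_of_nonpos hr0.le (by linarith)
  have g1 : (2 * ε * r - 1) * M + r ≤ 0 := by
    by_contra! h; exact absurd f1 (not_le.2 (by positivity))
  have g2 : (2 * ε * r + 1) * M - r ≤ 0 := by
    by_contra! h; exact absurd f2 (not_le.2 (by positivity))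
  -- Adding `g1` and `g2` gives 4 ε r M ≤ 0.
  have : 0 < ε * r * M := by positivity
  nlinarith

/-- On the real line f takes only real values ≥ λ_ε, so every preimage of y is nonreal and therefore
not critical. -/
theorem exists_nonreal_regular_preimage (hε : 0 < ε) {y : ℂ}
    (hy : y.im ≠ 0 ∨ y.re < lambdaEps ε) :
    ∃ w : ℂ, taylorCoeff ε 0 w = y ∧ taylorCoeff ε 1 w ≠ 0 := by
  obtain ⟨w, hw⟩ := taylorCoeff_zero_surjective hε y
  refine ⟨w, hw, taylorCoeff_one_ne_zero hε fun him => ?_⟩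
  obtain ⟨x, rfl⟩ : ∃ x : ℝ, w = x := ⟨w.re, by apply Complex.ext <;> simp [him]⟩
  rw [← ofReal_taylorCoeff hε] at hw
  rcases hy with h | h
  · exact h (by rw [← hw, Complex.ofReal_im])
  · rw [← hw, Complex.ofReal_re] at h
    exact absurd (lambdaEps_le_taylorCoeff hε x) (not_le.2 h)

end ComplexVariable

end

/-! ### Newton lifting in finite-dimensional commutative algebras. -/

section

open Filter Topology Polynomial

/-- In a finite-dimensional algebra, `a` is the sum of the power series of `Ψ_ε` at `W`. The
convergence is expressed by linear functionals, so that no norm has to be chosen. -/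
def IsSeriesValue (ε : ℝ) {S : Type*} [Ring S] [Algebra ℝ S] (W a : S) : Prop :=
  ∀ φ : Module.Dual ℝ S, HasSum (fun n => coef ε n * φ (W ^ n)) (φ a)

/-- A uniform exponent is needed: the Taylor polynomial must be truncated before the nilpotent
correction is known. -/
theorem exists_forall_isNilpotent_pow_eq_zero (S : Type*) [CommRing S] [IsNoetherianRing S] :
    ∃ m : ℕ, ∀ s : S, IsNilpotent s → s ^ m = 0 := by
  obtain ⟨m, hm⟩ := IsNoetherianRing.isNilpotent_nilradical S
  refine ⟨m, fun s hs => ?_⟩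
  have := Ideal.pow_mem_pow (mem_nilradical.2 hs) m
  rw [hm] at this
  simpa using this

section Normed

variable {ε : ℝ} {S : Type*} [NormedCommRing S] [NormedAlgebra ℝ S] [FiniteDimensional ℝ S]

theorem isSeriesValue_taylorCoeff [CompleteSpace S] (hε : 0 < ε) (W : S) :
    IsSeriesValue ε W (taylorCoeff ε 0 W) := fun φ => by
  have := (hasSum_taylorCoeff_zero hε W).map φ φ.continuous_of_finiteDimensional
  convert! this using 2 with n
  simp

/-- Newton lifting for the power series. -/
theorem exists_taylorCoeff_zero_eq (hε : 0 < ε) {a W₀ : S}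
    (h0 : IsNilpotent (taylorCoeff ε 0 W₀ - a)) (h1 : IsUnit (taylorCoeff ε 1 W₀)) :
    ∃ W : S, taylorCoeff ε 0 W = a := by
  have : CompleteSpace S := FiniteDimensional.complete ℝ S
  have : IsNoetherianRing S := isNoetherian_of_tower ℝ inferInstance
  obtain ⟨m, hm⟩ := exists_forall_isNilpotent_pow_eq_zero S
  -- On nilpotent increments this truncation equals f(W₀ + ·) - a exactly. The two extra terms keep
  -- the linear coefficient even for m = 0.
  set P : S[X] := ∑ k ∈ Finset.range (m + 2), C (taylorCoeff ε k W₀) * X ^ k - C a with hP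
  have hc : ∀ i < m + 2, (∑ k ∈ Finset.range (m + 2), C (taylorCoeff ε k W₀) * X ^ k).coeff i =
      taylorCoeff ε i W₀ := fun i hi => by
    simp [hi]
  have e0 : aeval (0 : S) P = taylorCoeff ε 0 W₀ - a := by
    rw [← coeff_zero_eq_aeval_zero, hP, coeff_sub, hc 0 (by omega), coeff_C_zero]
  have e1 : aeval (0 : S) (derivative P) = taylorCoeff ε 1 W₀ := by
    rw [← coeff_zero_eq_aeval_zero, hP, coeff_derivative, coeff_sub, hc 1 (by omega),
      coeff_C_succ]
    simp
  obtain ⟨r, ⟨hr1, hr2⟩, -⟩ := existsUnique_nilpotent_sub_and_aeval_eq_zero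
    (P := P) (x := (0 : S)) (e0 ▸ h0) (e1 ▸ h1)
  have hr : IsNilpotent r := by simpa using hr1
  refine ⟨W₀ + r, ?_⟩
  rw [taylorCoeff_zero_add hε (Commute.all _ _)
    (pow_eq_zero_of_le (by omega : m ≤ m + 2) (hm r hr))]
  have : aeval r P = ∑ k ∈ Finset.range (m + 2), taylorCoeff ε k W₀ * r ^ k - a := by
    simp [hP, map_sum]
  rw [this] at hr2
  exact sub_eq_zero.1 hr2

/-- Newton lifting at a nondegenerate minimum, where the increment has a square root. -/
theorem exists_taylorCoeff_zero_eq_add_sq (hε : 0 < ε) {w₀ : ℝ} {ω : S} (hω : IsNilpotent ω)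
    (h1 : taylorCoeff ε 1 w₀ = 0) (h2 : 0 < taylorCoeff ε 2 w₀) :
    ∃ W : S, taylorCoeff ε 0 W = algebraMap ℝ S (taylorCoeff ε 0 w₀) + ω ^ 2 := by
  have : CompleteSpace S := FiniteDimensional.complete ℝ S
  obtain ⟨m, hm⟩ := hω
  set b : ℕ → S := fun k => algebraMap ℝ S (taylorCoeff ε k w₀) with hb
  -- For an increment ω r the Taylor expansion is ω² Σ b_{k+2} ω^k r^{k+2}, so it suffices that this
  -- sum be 1. Modulo ω the equation is b₂ r² = 1, with the simple root ρ = 1/√b₂.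
  set P : S[X] := ∑ k ∈ Finset.range (m + 1), C (b (k + 2) * ω ^ k) * X ^ (k + 2) - 1 with hP
  set ρ : ℝ := 1 / √(taylorCoeff ε 2 w₀) with hρ
  have hs : 0 < √(taylorCoeff ε 2 w₀) := Real.sqrt_pos.2 h2
  have hρ2 : taylorCoeff ε 2 w₀ * ρ ^ 2 = 1 := by
    rw [hρ, div_pow, Real.sq_sqrt h2.le]; field_simp
  set x : S := algebraMap ℝ S ρ with hx
  have hωn : ∀ y : S, IsNilpotent (y * ω) := fun y => ⟨m, by rw [mul_pow, hm, mul_zero]⟩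
  have hPe : ∀ y : S, aeval y P =
      ∑ k ∈ Finset.range (m + 1), b (k + 2) * ω ^ k * y ^ (k + 2) - 1 := fun y => by
    simp [hP, map_sum]
  have e0 : IsNilpotent (aeval x P) := by
    have : aeval x P = (∑ k ∈ Finset.range m, b (k + 1 + 2) * ω ^ k * x ^ (k + 1 + 2)) * ω := by
      have h3 : b 2 * x ^ 2 = 1 := by
        simp only [hb, hx]
        rw [← map_pow, ← map_mul, hρ2, map_one]
      rw [hPe, Finset.sum_range_succ', Finset.sum_mul, zero_add, pow_zero, mul_one, h3,
        add_sub_cancel_right]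
      exact Finset.sum_congr rfl fun k _ => by ring
    rw [this]
    exact hωn _
  have e1 : IsUnit (aeval x (derivative P)) := by
    have hPd : aeval x (derivative P) =
        ∑ k ∈ Finset.range (m + 1), b (k + 2) * ω ^ k * ((k + 2 : ℕ) * x ^ (k + 1)) := by
      simp only [hP, derivative_sub, derivative_one, sub_zero, map_sum]
      refine Finset.sum_congr rfl fun k _ => ?_
      rw [derivative_C_mul_X_pow]
      simp
      ring
    have : aeval x (derivative P) = (∑ k ∈ Finset.range m,
        b (k + 1 + 2) * ω ^ k * ((k + 1 + 2 : ℕ) * x ^ (k + 1 + 1))) * ω +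
        algebraMap ℝ S (2 * taylorCoeff ε 2 w₀ * ρ) := by
      rw [hPd, Finset.sum_range_succ', Finset.sum_mul]
      congr 1
      · exact Finset.sum_congr rfl fun k _ => by ring
      · simp [hb, hx, map_ofNat]; ring
    rw [this]
    refine IsNilpotent.isUnit_add_right_of_commute (hωn _) ?_ (Commute.all _ _)
    refine (IsUnit.mk0 _ ?_).map (algebraMap ℝ S)
    have : ρ ≠ 0 := by positivity
    have := h2.ne'
    positivity
  obtain ⟨r, ⟨-, hr⟩, -⟩ := existsUnique_nilpotent_sub_and_aeval_eq_zero e0 e1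
  refine ⟨algebraMap ℝ S w₀ + ω * r, ?_⟩
  have hz : (ω * r) ^ (m + 1 + 2) = 0 :=
    pow_eq_zero_of_le (by omega : m ≤ m + 1 + 2) (by rw [mul_pow, hm, zero_mul])
  rw [taylorCoeff_zero_add hε (Commute.all _ _) hz]
  simp only [taylorCoeff_algebraMap hε]
  rw [Finset.sum_range_succ', Finset.sum_range_succ']
  have hr' : ∑ k ∈ Finset.range (m + 1), b (k + 2) * ω ^ k * r ^ (k + 2) = 1 := by
    rw [hPe] at hr
    exact sub_eq_zero.1 hr
  have : ∑ k ∈ Finset.range (m + 1), b (k + 1 + 1) * (ω * r) ^ (k + 1 + 1) = ω ^ 2 := by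
    calc _ = ω ^ 2 * ∑ k ∈ Finset.range (m + 1), b (k + 2) * ω ^ k * r ^ (k + 2) := by
          rw [Finset.mul_sum]
          exact Finset.sum_congr rfl fun k _ => by ring
      _ = _ := by rw [hr', mul_one]
  rw [this, zero_add, h1]
  simp [add_comm]

end Normed

section FiniteDimensional

variable {ε : ℝ} {S : Type*} [CommRing S] [Algebra ℝ S] [FiniteDimensional ℝ S]

attribute [local instance] Matrix.linftyOpNormedRing Matrix.linftyOpNormedAlgebra

/-- A norm on a finite-dimensional commutative algebra, induced by the regular representation. -/
abbrev regularNormedCommRing (S : Type*) [CommRing S] [Algebra ℝ S] [FiniteDimensional ℝ S] :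
    NormedCommRing S :=
  NormedCommRing.induced S (Matrix (Fin (Module.finrank ℝ S)) (Fin (Module.finrank ℝ S)) ℝ)
    (Algebra.leftMulMatrix (Module.finBasis ℝ S)) (Algebra.leftMulMatrix_injective _)

/-- The normed algebra structure for `regularNormedCommRing`. -/
abbrev regularNormedAlgebra (S : Type*) [CommRing S] [Algebra ℝ S] [FiniteDimensional ℝ S] :
    letI := regularNormedCommRing S
    NormedAlgebra ℝ S :=
  letI := regularNormedCommRing S
  NormedAlgebra.induced ℝ S (Matrix (Fin (Module.finrank ℝ S)) (Fin (Module.finrank ℝ S)) ℝ)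
    (Algebra.leftMulMatrix (Module.finBasis ℝ S))

/-- Both hypotheses of Newton lifting hold modulo nilpotents and can thus be tested in ℂ through π.
As π may have image ℝ only, a lift `t` of the inverse of f'(π W₀) is part of the data. -/
theorem exists_isSeriesValue (hε : 0 < ε) (π : S →ₐ[ℝ] ℂ) (hπ : ∀ s, π s = 0 → IsNilpotent s)
    {a W₀ t : S} (h0 : taylorCoeff ε 0 (π W₀) = π a) (h1 : π t * taylorCoeff ε 1 (π W₀) = 1) :
    ∃ W : S, IsSeriesValue ε W a := by
  letI := regularNormedCommRing S
  letI := regularNormedAlgebra S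
  have : CompleteSpace S := FiniteDimensional.complete ℝ S
  have hc : Continuous π := π.toLinearMap.continuous_of_finiteDimensional
  obtain ⟨W, hW⟩ := exists_taylorCoeff_zero_eq hε (a := a) (W₀ := W₀)
    (hπ _ (by rw [map_sub, map_taylorCoeff hε 0 π hc, h0, sub_self])) (by
      have : IsNilpotent (t * taylorCoeff ε 1 W₀ - 1) :=
        hπ _ (by rw [map_sub, map_mul, map_taylorCoeff hε 1 π hc, h1, map_one, sub_self])
      have h2 : IsUnit (t * taylorCoeff ε 1 W₀) := by
        have := this.isUnit_add_one
        rwa [sub_add_cancel] at this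
      exact isUnit_of_mul_isUnit_right h2)
  exact ⟨W, hW ▸ isSeriesValue_taylorCoeff hε W⟩

theorem exists_isSeriesValue_add_sq (hε : 0 < ε) {w₀ : ℝ} {ω : S} (hω : IsNilpotent ω)
    (h1 : taylorCoeff ε 1 w₀ = 0) (h2 : 0 < taylorCoeff ε 2 w₀) :
    ∃ W : S, IsSeriesValue ε W (algebraMap ℝ S (taylorCoeff ε 0 w₀) + ω ^ 2) := by
  letI := regularNormedCommRing S
  letI := regularNormedAlgebra S
  have : CompleteSpace S := FiniteDimensional.complete ℝ S
  obtain ⟨W, hW⟩ := exists_taylorCoeff_zero_eq_add_sq hε hω h1 h2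
  exact ⟨W, hW ▸ isSeriesValue_taylorCoeff hε W⟩

end FiniteDimensional

end

/-! ### Kernel dimensions, Jordan blocks and the primary decomposition. -/

section

open Polynomial Module DirectSum

section Intertwine

variable {K : Type*} [Field K] {ι : Type*} {M : ι → Type*}
  [∀ i, AddCommGroup (M i)] [∀ i, Module K (M i)] {V : Type*} [AddCommGroup V] [Module K V]

theorem pow_apply_of_equiv_pi (E : V ≃ₗ[K] ∀ i, M i) {A : End K V} {B : ∀ i, End K (M i)}
    (h : ∀ v i, E (A v) i = B i (E v i)) (k : ℕ) (v : V) (i : ι) :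
    E ((A ^ k) v) i = (B i ^ k) (E v i) := by
  induction k generalizing v with
  | zero => simp
  | succ k ih => rw [pow_succ, pow_succ, End.mul_apply, End.mul_apply, ih, h]

theorem finrank_ker_of_equiv_pi [Fintype ι] [∀ i, FiniteDimensional K (M i)]
    (E : V ≃ₗ[K] ∀ i, M i) {A : End K V} {B : ∀ i, End K (M i)}
    (h : ∀ v i, E (A v) i = B i (E v i)) :
    finrank K (LinearMap.ker A) = ∑ i, finrank K (LinearMap.ker (B i)) := by
  let F : LinearMap.ker A ≃ₗ[K] ∀ i, LinearMap.ker (B i) :=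
    { toFun := fun v i => ⟨E v.1 i, by
        rw [LinearMap.mem_ker, ← h, LinearMap.mem_ker.1 v.2, map_zero, Pi.zero_apply]⟩
      map_add' := fun v w => by ext i; simp
      map_smul' := fun c v => by ext i; simp
      invFun := fun f => ⟨E.symm fun i => (f i).1, by
        rw [LinearMap.mem_ker, ← E.map_eq_zero_iff]
        ext i
        rw [h, E.apply_symm_apply]
        exact (f i).2⟩
      left_inv := fun v => by ext; simp
      right_inv := fun f => by ext i; simp }
  rw [F.finrank_eq, finrank_pi_fintype]

theorem finrank_ker_of_equiv {W : Type*} [AddCommGroup W] [Module K W] (E : V ≃ₗ[K] W)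
    {A : End K V} {B : End K W} (h : ∀ v, E (A v) = B (E v)) :
    finrank K (LinearMap.ker A) = finrank K (LinearMap.ker B) := by
  refine (LinearEquiv.ofSubmodules E (LinearMap.ker A) (LinearMap.ker B) ?_).finrank_eq
  ext w
  rw [Submodule.mem_map_equiv, LinearMap.mem_ker, LinearMap.mem_ker, ← E.map_eq_zero_iff, h,
    E.apply_symm_apply]

end Intertwine

/-- The dimension of the kernel of `(T - μ) ^ k`. -/
def kerDim {K V : Type*} [Field K] [AddCommGroup V] [Module K V] (T : End K V) (μ : K) (k : ℕ) : ℕ :=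
  finrank K (LinearMap.ker ((T - algebraMap K (End K V) μ) ^ k))

section KerDim

variable {K : Type*} [Field K] {V : Type*} [AddCommGroup V] [Module K V]

theorem kerDim_of_equiv_pi {ι : Type*} [Fintype ι] {M : ι → Type*} [∀ i, AddCommGroup (M i)]
    [∀ i, Module K (M i)] [∀ i, FiniteDimensional K (M i)]
    (E : V ≃ₗ[K] ∀ i, M i) {A : End K V} {B : ∀ i, End K (M i)}
    (h : ∀ v i, E (A v) i = B i (E v i)) (μ : K) (k : ℕ) :
    kerDim A μ k = ∑ i, kerDim (B i) μ k :=
  finrank_ker_of_equiv_pi E fun v i => pow_apply_of_equiv_pi E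
    (B := fun i => B i - algebraMap K (End K (M i)) μ) (fun v i => by simp [h]) k v i

theorem kerDim_of_equiv {W : Type*} [AddCommGroup W] [Module K W] (E : V ≃ₗ[K] W)
    {A : End K V} {B : End K W} (h : ∀ v, E (A v) = B (E v)) (μ : K) (k : ℕ) :
    kerDim A μ k = kerDim B μ k := by
  refine finrank_ker_of_equiv E ?_
  induction k with
  | zero => simp
  | succ k ih =>
    intro v
    rw [pow_succ, pow_succ, End.mul_apply, End.mul_apply, ih]
    simp [h]

end KerDim

section Shift

variable (K : Type*) [Field K]

/-- The shift `(v₀, v₁, …) ↦ (v₁, v₂, …, 0)`. -/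
def shiftEnd (e : ℕ) : End K (Fin e → K) :=
  LinearMap.pi fun i => if h : (i : ℕ) + 1 < e then LinearMap.proj ⟨(i : ℕ) + 1, h⟩ else 0

theorem shiftEnd_apply {e : ℕ} (v : Fin e → K) (i : Fin e) :
    shiftEnd K e v i = if h : (i : ℕ) + 1 < e then v ⟨(i : ℕ) + 1, h⟩ else 0 := by
  rw [shiftEnd, LinearMap.pi_apply]
  split_ifs <;> simp

theorem shiftEnd_pow_apply {e : ℕ} (k : ℕ) (v : Fin e → K) (i : Fin e) :
    (shiftEnd K e ^ k) v i = if h : (i : ℕ) + k < e then v ⟨(i : ℕ) + k, h⟩ else 0 := by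
  induction k generalizing i with
  | zero => simp
  | succ k ih =>
    rw [pow_succ', End.mul_apply, shiftEnd_apply]
    by_cases h : (i : ℕ) + 1 < e
    · rw [dif_pos h, ih]
      simp only [add_assoc, add_comm 1 k]
    · rw [dif_neg h, dif_neg (by omega)]

theorem finrank_ker_shiftEnd_pow (e k : ℕ) :
    finrank K (LinearMap.ker (shiftEnd K e ^ k)) = min k e := by
  classical
  have hker : LinearMap.ker (shiftEnd K e ^ k) =
      ⨅ i ∈ {i : Fin e | ¬ (i : ℕ) < k}, LinearMap.ker (LinearMap.proj i : (Fin e → K) →ₗ[K] K) := by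
    ext v
    simp only [LinearMap.mem_ker, Submodule.mem_iInf, LinearMap.proj_apply, Set.mem_ofPred_eq]
    constructor
    · intro h i hi
      have hi' : (i : ℕ) - k < e := by omega
      have := congrFun h ⟨(i : ℕ) - k, hi'⟩
      rw [shiftEnd_pow_apply, dif_pos (by simp; omega)] at this
      have e1 : (⟨(i : ℕ) - k + k, by omega⟩ : Fin e) = i := Fin.ext (by simp; omega)
      simpa [e1] using this
    · intro h
      ext i
      rw [shiftEnd_pow_apply]
      split_ifs with hi
      · exact h _ (by simp)
      · rfl
  rw [hker]
  have := (LinearMap.iInfKerProjEquiv K (fun _ : Fin e => K) (I := {i : Fin e | (i : ℕ) < k})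
    (J := {i : Fin e | ¬ (i : ℕ) < k}) (Set.disjoint_left.2 fun i hi hj => hj hi)
    (fun i _ => em _)).finrank_eq
  rw [this, finrank_fintype_fun_eq_card, Fintype.card_subtype]
  change (Finset.univ.filter fun i : Fin e => (i : ℕ) < k).card = _
  rw [Fin.card_filter_val_lt, min_comm]

theorem isNilpotent_shiftEnd (e : ℕ) : IsNilpotent (shiftEnd K e) :=
  ⟨e, by ext v i; simp [shiftEnd_pow_apply]⟩

variable {K}

theorem kerDim_eq_zero_of_isUnit {V : Type*} [AddCommGroup V] [Module K V] {T : End K V} {μ : K}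
    (h : IsUnit (T - algebraMap K (End K V) μ)) (k : ℕ) : kerDim T μ k = 0 := by
  rw [kerDim, LinearMap.ker_eq_bot_of_injective ((End.isUnit_iff _).1 (h.pow k)).1]
  simp

theorem kerDim_shiftEnd_add (e : ℕ) (μ ν : K) (k : ℕ) [Decidable (ν = μ)] :
    kerDim (shiftEnd K e + algebraMap K (End K (Fin e → K)) ν) μ k =
      if ν = μ then min k e else 0 := by
  split_ifs with h
  · rw [kerDim, h, add_sub_cancel_right, finrank_ker_shiftEnd_pow]
  · refine kerDim_eq_zero_of_isUnit ?_ k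
    rw [add_sub_assoc, ← map_sub]
    exact (isNilpotent_shiftEnd K e).isUnit_add_right_of_commute
      ((IsUnit.mk0 _ (sub_ne_zero.2 h)).map (algebraMap K _)) (Algebra.commutes _ _).symm

end Shift

section AdjoinRoot

variable {K : Type*} [Field K]

theorem finiteDimensional_adjoinRoot {q : K[X]} (hq : q.Monic) :
    FiniteDimensional K (AdjoinRoot q) :=
  (AdjoinRoot.powerBasis' hq).finite

theorem finrank_adjoinRoot {q : K[X]} (hq : q.Monic) : finrank K (AdjoinRoot q) = q.natDegree := by
  rw [(AdjoinRoot.powerBasis' hq).finrank, AdjoinRoot.powerBasis'_dim]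

theorem root_sub_pow_eq_zero (μ : K) (e : ℕ) :
    (AdjoinRoot.root ((X - C μ) ^ e) - algebraMap K _ μ) ^ e = 0 := by
  have : (AdjoinRoot.mk ((X - C μ) ^ e)) ((X - C μ) ^ e) = 0 := AdjoinRoot.mk_self
  rw [map_pow, map_sub, AdjoinRoot.mk_X, AdjoinRoot.mk_C] at this
  exact this

/-- The basis of `K[X] / (X - μ) ^ e` formed by the powers of `X - μ` in decreasing order. -/
theorem exists_basis_adjoinRoot_pow (μ : K) (e : ℕ) :
    ∃ b : Basis (Fin e) K (AdjoinRoot ((X - C μ) ^ e)), ∀ i : Fin e,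
      b i = (AdjoinRoot.root ((X - C μ) ^ e) - algebraMap K _ μ) ^ (e - 1 - (i : ℕ)) := by
  have hm : ((X - C μ) ^ e).Monic := (monic_X_sub_C μ).pow e
  have hdeg : ((X - C μ) ^ e).natDegree = e := by
    rw [natDegree_pow, natDegree_X_sub_C, mul_one]
  set x := AdjoinRoot.root ((X - C μ) ^ e) - algebraMap K _ μ with hx
  have hli : LinearIndependent K fun i : Fin e => x ^ (i : ℕ) := by
    rw [Fintype.linearIndependent_iff]
    intro c hc
    -- A linear relation among the powers of X - μ makes g(X - μ), of degree below e, divisible by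
    -- (X - μ)^e.
    set g : K[X] := ∑ i : Fin e, C (c i) * X ^ (i : ℕ) with hg
    have hgd : g.degree < e := by
      refine (degree_sum_le _ _).trans_lt ((Finset.sup_lt_iff (WithBot.bot_lt_coe e)).2 fun i _ => ?_)
      exact (degree_C_mul_X_pow_le _ _).trans_lt (WithBot.coe_lt_coe.2 i.2)
    have hmk : AdjoinRoot.mk ((X - C μ) ^ e) (g.comp (X - C μ)) = 0 := by
      rw [← hc, hg]
      simp only [Polynomial.sum_comp, mul_comp, C_comp, X_pow_comp, map_sum, map_mul, map_pow,
        map_sub, AdjoinRoot.mk_X, AdjoinRoot.mk_C, Algebra.smul_def, hx]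
      rfl
    rw [AdjoinRoot.mk_eq_zero] at hmk
    have hcomp : g.comp (X - C μ) = 0 := by
      refine eq_zero_of_dvd_of_degree_lt hmk ?_
      by_cases h0 : g = 0
      · simp [h0, bot_lt_iff_ne_bot]
      · rw [degree_eq_natDegree hm.ne_zero, hdeg]
        refine degree_le_natDegree.trans_lt ?_
        rw [natDegree_comp, natDegree_X_sub_C, mul_one]
        rw [degree_eq_natDegree h0] at hgd
        exact_mod_cast hgd
    have hg0 : g = 0 := by
      have := congrArg (fun p => p.comp (X + C μ)) hcomp
      simpa [comp_assoc] using this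
    intro i
    have := congrArg (fun p => coeff p (i : ℕ)) hg0
    simpa [hg, finsetSum_coeff, coeff_C_mul_X_pow, Fin.val_inj] using this
  have hcard : Fintype.card (Fin e) = finrank K (AdjoinRoot ((X - C μ) ^ e)) := by
    rw [finrank_adjoinRoot hm, hdeg, Fintype.card_fin]
  have := finiteDimensional_adjoinRoot hm
  rcases Nat.eq_zero_or_pos e with rfl | he
  · exact ⟨basisOfLinearIndependentOfCardEqFinrank' _ hli hcard, fun i => i.elim0⟩
  · have : Nonempty (Fin e) := ⟨⟨0, he⟩⟩
    refine ⟨(basisOfLinearIndependentOfCardEqFinrank hli hcard).reindex Fin.revPerm, fun i => ?_⟩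
    simp only [Basis.coe_reindex, coe_basisOfLinearIndependentOfCardEqFinrank, Function.comp]
    congr 1
    simp [Fin.val_rev]
    omega

/-- In coordinates, multiplication by `X` on `K[X] / (X - μ) ^ e` is a Jordan block. -/
theorem exists_equiv_adjoinRoot_pow (μ : K) (e : ℕ) :
    ∃ E : AdjoinRoot ((X - C μ) ^ e) ≃ₗ[K] (Fin e → K), ∀ y,
      E (AdjoinRoot.root _ * y) = (shiftEnd K e + algebraMap K (End K (Fin e → K)) μ) (E y) := by
  obtain ⟨b, hb⟩ := exists_basis_adjoinRoot_pow μ e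
  refine ⟨b.equivFun, fun y => ?_⟩
  set x := AdjoinRoot.root ((X - C μ) ^ e) - algebraMap K _ μ with hx
  have hroot : AdjoinRoot.root ((X - C μ) ^ e) = x + algebraMap K _ μ := by rw [hx]; ring
  have key : b.equivFun.toLinearMap ∘ₗ LinearMap.mulLeft K x =
      shiftEnd K e ∘ₗ b.equivFun.toLinearMap := by
    refine b.ext fun j => ?_
    ext i
    simp only [LinearMap.comp_apply, LinearEquiv.coe_coe, LinearMap.mulLeft_apply, shiftEnd_apply]
    by_cases hj : (j : ℕ) = 0
    · have h1 : x * b j = 0 := by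
        rw [hb, ← pow_succ', show e - 1 - (j : ℕ) + 1 = e by omega, root_sub_pow_eq_zero]
      rw [h1, map_zero, Pi.zero_apply]
      split_ifs with h
      · rw [Basis.equivFun_self, if_neg]
        intro h2
        rw [h2] at hj
        simp at hj
      · rfl
    · have h1 : x * b j = b ⟨(j : ℕ) - 1, by omega⟩ := by
        rw [hb, hb, ← pow_succ']
        congr 1
        simp only
        omega
      rw [h1, Basis.equivFun_self]
      split_ifs with h2 h3 h3
      · rw [Basis.equivFun_self, if_pos]
        have h4 := congrArg Fin.val h2
        apply Fin.ext
        simp only at h4 ⊢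
        omega
      · exfalso; rw [← h2] at h3; simp at h3; omega
      · rw [Basis.equivFun_self, if_neg]
        intro h4
        apply h2
        ext; simp [h4]
      · rfl
  have := LinearMap.congr_fun key y
  rw [hroot, add_mul, map_add, LinearMap.add_apply]
  congr 1
  rw [← Algebra.smul_def, map_smul]
  simp

/-- For p ≠ X - μ, a Bézout relation between X - μ and p^e makes X - μ invertible in the quotient.
-/
theorem kerDim_adjoinRoot_pow {p : K[X]} (hp : Irreducible p) (hm : p.Monic) (e : ℕ) (μ : K)
    (k : ℕ) [Decidable (p = X - C μ)] :
    kerDim (LinearMap.mulLeft K (AdjoinRoot.root (p ^ e))) μ k =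
      if p = X - C μ then min k e else 0 := by
  split_ifs with h
  · subst h
    obtain ⟨E, hE⟩ := exists_equiv_adjoinRoot_pow μ e
    classical
    rw [kerDim_of_equiv E (B := shiftEnd K e + algebraMap K (End K (Fin e → K)) μ) (fun v => hE v),
      kerDim_shiftEnd_add, if_pos rfl]
  · refine kerDim_eq_zero_of_isUnit ?_ k
    have hcop : IsCoprime (X - C μ) (p ^ e) := by
      refine IsCoprime.pow_right ?_
      rw [(irreducible_X_sub_C μ).coprime_iff_not_dvd]
      intro hd
      exact h (eq_of_monic_of_associated hm (monic_X_sub_C μ)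
        ((irreducible_X_sub_C μ).associated_of_dvd hp hd).symm)
    obtain ⟨u, v, huv⟩ := hcop
    have hu : IsUnit (AdjoinRoot.root (p ^ e) - algebraMap K (AdjoinRoot (p ^ e)) μ) := by
      refine IsUnit.of_mul_eq_one (AdjoinRoot.mk (p ^ e) u) ?_
      have := congrArg (AdjoinRoot.mk (p ^ e)) huv
      rw [map_add, map_mul, map_mul, AdjoinRoot.mk_self, mul_zero, add_zero, map_sub,
        AdjoinRoot.mk_X, AdjoinRoot.mk_C, map_one] at this
      rw [mul_comm]; exact this
    have := hu.map (Algebra.lmul K (AdjoinRoot (p ^ e)))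
    rw [map_sub] at this
    convert this using 2
    · rfl
    · exact (AlgHom.commutes (Algebra.lmul K (AdjoinRoot (p ^ e))) μ).symm

end AdjoinRoot

section Primary

universe u

/-- The quotient module `K[X] / (q)` is the underlying vector space of `AdjoinRoot q`. -/
def quotientEquivAdjoinRoot {K : Type*} [Field K] (q : K[X]) :
    (K[X] ⧸ Submodule.span K[X] {q}) ≃ₗ[K] AdjoinRoot q :=
  LinearEquiv.refl K (AdjoinRoot q)

theorem quotientEquivAdjoinRoot_X_smul {K : Type*} [Field K] (q : K[X])
    (x : K[X] ⧸ Submodule.span K[X] {q}) :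
    quotientEquivAdjoinRoot q ((X : K[X]) • x) =
      AdjoinRoot.root q * quotientEquivAdjoinRoot q x := by
  obtain ⟨f, rfl⟩ := Submodule.Quotient.mk_surjective _ x
  rfl

/-- The primary decomposition of an endomorphism into cyclic pieces. -/
theorem exists_primary_equiv {K : Type u} [Field K] {V : Type*} [AddCommGroup V] [Module K V]
    [FiniteDimensional K V] (T : End K V) :
    ∃ (ι : Type u) (_ : Fintype ι) (p : ι → K[X]) (e : ι → ℕ),
      (∀ i, Irreducible (p i)) ∧ (∀ i, (p i).Monic) ∧ (∀ i, 0 < e i) ∧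
      ∃ E : V ≃ₗ[K] ∀ i, AdjoinRoot (p i ^ e i), ∀ v i,
        E (T v) i = LinearMap.mulLeft K (AdjoinRoot.root (p i ^ e i)) (E v i) := by
  classical
  -- V becomes a K[X]-module with X acting as T. The minimal polynomial kills it, so the structure
  -- theorem over a principal ideal domain applies.
  have htors : Module.IsTorsion K[X] (AEval' T) := by
    intro x
    refine ⟨⟨minpoly K T, mem_nonZeroDivisors_of_ne_zero
      (minpoly.ne_zero (Algebra.IsIntegral.isIntegral T))⟩, ?_⟩
    obtain ⟨m, rfl⟩ := (AEval'.of T).surjective x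
    change minpoly K T • (AEval.of K V T m) = 0
    rw [← AEval.of_aeval_smul, minpoly.aeval, zero_smul, map_zero]
  obtain ⟨ι, _, p, hp, e, ⟨F⟩⟩ := Module.equiv_directSum_of_isTorsion htors
  let G : (⨁ i : ι, K[X] ⧸ Submodule.span K[X] {p i ^ e i}) ≃ₗ[K[X]]
      ∀ i, K[X] ⧸ Submodule.span K[X] {p i ^ e i} := DirectSum.linearEquivFunOnFintype K[X] ι _
  have hassoc : ∀ i, Associated (p i ^ e i) (normalize (p i) ^ e i) := fun i =>
    (normalize_associated (p i)).symm.pow_pow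
  let H : ∀ i, (K[X] ⧸ Submodule.span K[X] {p i ^ e i}) ≃ₗ[K] AdjoinRoot (normalize (p i) ^ e i) :=
    fun i => (quotientEquivAdjoinRoot _).trans
      (AdjoinRoot.algEquivOfAssociated K _ _ (hassoc i)).toLinearEquiv
  have hH : ∀ i x, H i ((X : K[X]) • x) = AdjoinRoot.root _ * H i x := fun i x => by
    simp only [H, LinearEquiv.trans_apply, quotientEquivAdjoinRoot_X_smul]
    simp
  let E₀ : V ≃ₗ[K] ∀ i, AdjoinRoot (normalize (p i) ^ e i) :=
    ((AEval'.of T).trans ((F.trans G).restrictScalars K)).trans (LinearEquiv.piCongrRight H)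
  have hE₀ : ∀ v i, E₀ (T v) i = AdjoinRoot.root _ * E₀ v i := fun v i => by
    simp only [E₀, LinearEquiv.trans_apply, LinearEquiv.piCongrRight_apply,
      LinearEquiv.restrictScalars_apply, ← AEval'.X_smul_of, map_smul, Pi.smul_apply, hH]
  have hsub : ∀ i, e i = 0 → Subsingleton (AdjoinRoot (normalize (p i) ^ e i)) := fun i hi => by
    refine subsingleton_of_zero_eq_one ?_
    have := (AdjoinRoot.mk_self (f := normalize (p i) ^ e i))
    rw [hi, pow_zero] at this ⊢
    rw [← this, map_one]
  -- Factors with exponent 0 are trivial modules and are dropped.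
  let R : (∀ i, AdjoinRoot (normalize (p i) ^ e i)) →ₗ[K]
      ∀ i : {i // 0 < e i}, AdjoinRoot (normalize (p i.1) ^ e i.1) :=
    LinearMap.pi fun i => LinearMap.proj i.1
  have hR : Function.Bijective R := by
    constructor
    · intro f g hfg
      ext i
      by_cases hi : 0 < e i
      · exact congrFun hfg ⟨i, hi⟩
      · have := hsub i (by omega)
        exact Subsingleton.elim _ _
    · intro f
      refine ⟨fun i => if hi : 0 < e i then f ⟨i, hi⟩ else 0, ?_⟩
      ext i
      simp [R, i.2]
  refine ⟨{i // 0 < e i}, inferInstance, fun i => normalize (p i.1), fun i => e i.1,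
    fun i => (normalize_associated (p i.1)).symm.irreducible (hp i.1),
    fun i => monic_normalize (hp i.1).ne_zero, fun i => i.2,
    E₀.trans (LinearEquiv.ofBijective R hR), fun v i => ?_⟩
  simp only [LinearEquiv.trans_apply, LinearEquiv.ofBijective_apply, R, LinearMap.pi_apply,
    LinearMap.proj_apply, hE₀, LinearMap.mulLeft_apply]

end Primary

end

/-! ### Solving f(W) = T on single blocks and on pairs of equal blocks. -/

section

open Polynomial Module

section SeriesImage

variable {ε : ℝ}

/-- The endomorphism `T` is the value of the power series of `Ψ_ε` at some endomorphism. -/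
def IsSeriesImage (ε : ℝ) {M : Type*} [AddCommGroup M] [Module ℝ M] (T : End ℝ M) : Prop :=
  ∃ W : End ℝ M, ∀ (m : M) (φ : Dual ℝ M),
    HasSum (fun n => coef ε n * φ ((W ^ n) m)) (φ (T m))

theorem IsSeriesValue.isSeriesImage {S : Type*} [CommRing S] [Algebra ℝ S] {W a : S}
    (h : IsSeriesValue ε W a) : IsSeriesImage ε (LinearMap.mulLeft ℝ a) :=
  ⟨LinearMap.mulLeft ℝ W, fun m φ => by
    simpa [LinearMap.pow_mulLeft] using h (φ ∘ₗ LinearMap.mulRight ℝ m)⟩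

theorem isSeriesValue_algebraMap {S : Type*} [Ring S] [Algebra ℝ S] (hε : 0 < ε) (w : ℝ) :
    IsSeriesValue ε (algebraMap ℝ S w) (algebraMap ℝ S (taylorCoeff ε 0 w)) := fun φ => by
  have h := (hasSum_taylorCoeff_zero hε w).mul_right (φ 1)
  convert! h using 2 with n
  · rw [← map_pow, Algebra.algebraMap_eq_smul_one, map_smul, smul_eq_mul, smul_eq_mul, mul_assoc]
  · rw [Algebra.algebraMap_eq_smul_one, map_smul, smul_eq_mul]

theorem IsSeriesImage.of_equiv {M N : Type*} [AddCommGroup M] [Module ℝ M] [AddCommGroup N]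
    [Module ℝ N] (E : M ≃ₗ[ℝ] N) {T : End ℝ M} {T' : End ℝ N} (h : ∀ m, E (T m) = T' (E m))
    (hT : IsSeriesImage ε T') : IsSeriesImage ε T := by
  obtain ⟨W, hW⟩ := hT
  refine ⟨E.symm.conj W, fun m φ => ?_⟩
  have hp : ∀ n, (E.symm.conj W) ^ n = E.symm.conj (W ^ n) := fun n =>
    (map_pow E.symm.conjRingEquiv W n).symm
  have := hW (E m) (φ ∘ₗ (E.symm : N →ₗ[ℝ] M))
  rw [← h] at this
  have key : ∀ n, (E.symm.conj W ^ n) m = E.symm ((W ^ n) (E m)) := fun n => by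
    rw [hp]; simp [LinearEquiv.conj_apply]
  simp only [key]
  simpa using this

/-- The diagonal endomorphism of a product. -/
def piEnd {ι : Type*} {M : ι → Type*} [∀ i, AddCommGroup (M i)] [∀ i, Module ℝ (M i)]
    (T : ∀ i, End ℝ (M i)) : End ℝ (∀ i, M i) :=
  LinearMap.pi fun i => T i ∘ₗ LinearMap.proj i

theorem piEnd_apply {ι : Type*} {M : ι → Type*} [∀ i, AddCommGroup (M i)] [∀ i, Module ℝ (M i)]
    (T : ∀ i, End ℝ (M i)) (f : ∀ i, M i) (i : ι) : piEnd T f i = T i (f i) := rfl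

theorem isSeriesImage_piEnd {ι : Type*} [Fintype ι] {M : ι → Type*} [∀ i, AddCommGroup (M i)]
    [∀ i, Module ℝ (M i)] {T : ∀ i, End ℝ (M i)} (h : ∀ i, IsSeriesImage ε (T i)) :
    IsSeriesImage ε (piEnd T) := by
  classical
  choose W hW using h
  refine ⟨piEnd W, fun m φ => ?_⟩
  have hφ : ∀ f : ∀ i, M i, φ f = ∑ i, (φ ∘ₗ LinearMap.single ℝ M i) (f i) := fun f => by
    conv_lhs => rw [← LinearMap.sum_single_apply M f, map_sum]
    rfl
  have hp : ∀ n i, ((piEnd W) ^ n) m i = (W i ^ n) (m i) := fun n i =>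
    pow_apply_of_equiv_pi (LinearEquiv.refl ℝ (∀ i, M i)) (fun v i => piEnd_apply W v i) n m i
  have := hasSum_sum (s := Finset.univ) fun i _ => hW i (m i) (φ ∘ₗ LinearMap.single ℝ M i)
  rw [hφ (piEnd T m)]
  convert! this using 2 with n
  rw [hφ, Finset.mul_sum]
  simp only [hp]

theorem isSeriesImage_piEnd_of_fibers {ι κ : Type*} [Fintype κ] (c : ι → κ) {M : ι → Type*}
    [∀ i, AddCommGroup (M i)] [∀ i, Module ℝ (M i)] {T : ∀ i, End ℝ (M i)}
    (h : ∀ k, IsSeriesImage ε (piEnd fun i : {i // c i = k} => T i.1)) :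
    IsSeriesImage ε (piEnd T) := by
  let E : (∀ i, M i) ≃ₗ[ℝ] ∀ k, ∀ i : {i // c i = k}, M i.1 :=
    { toFun := fun f k i => f i.1
      map_add' := fun _ _ => rfl
      map_smul' := fun _ _ => rfl
      invFun := fun g i => g (c i) ⟨i, rfl⟩
      left_inv := fun _ => rfl
      right_inv := fun g => by
        ext k ⟨i, rfl⟩
        rfl }
  exact (isSeriesImage_piEnd h).of_equiv E fun _ => rfl

/-- The index set is cut into pairs, since a pair can be an image where a single factor is not. -/
theorem isSeriesImage_piEnd_of_even {ι : Type*} [Fintype ι] (heven : Even (Fintype.card ι))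
    {M : ι → Type*} [∀ i, AddCommGroup (M i)] [∀ i, Module ℝ (M i)] {T : ∀ i, End ℝ (M i)}
    (h : ∀ s : Set ι, Nonempty (Fin 2 ≃ s) → IsSeriesImage ε (piEnd fun i : s => T i.1)) :
    IsSeriesImage ε (piEnd T) := by
  obtain ⟨r, hr⟩ := heven
  have e : ι ≃ Fin r × Fin 2 := Fintype.equivOfCardEq (by simp [hr]; omega)
  refine isSeriesImage_piEnd_of_fibers (fun i => (e i).1) fun k => ?_
  refine h {i | (e i).1 = k} ⟨⟨fun j => ⟨e.symm (k, j), by simp⟩, fun i => (e i.1).2, ?_, ?_⟩⟩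
  · intro j; simp
  · rintro ⟨i, rfl⟩; simp

end SeriesImage

section Blocks

variable {ε : ℝ}

/-- Evaluation at a complex root of `p` on `ℝ[X] / p ^ e`. -/
theorem exists_evalHom {p : ℝ[X]} (hp : Irreducible p) (hm : p.Monic) {e : ℕ} (he : 0 < e) {μ : ℂ}
    (hμ : aeval μ p = 0) : ∃ π : AdjoinRoot (p ^ e) →ₐ[ℝ] ℂ,
      (∀ g : ℝ[X], π (AdjoinRoot.mk _ g) = aeval μ g) ∧ ∀ s, π s = 0 → IsNilpotent s := by
  have h0 : (p ^ e).eval₂ (Algebra.ofId ℝ ℂ : ℝ →+* ℂ) μ = 0 := by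
    change aeval μ (p ^ e) = 0
    rw [map_pow, hμ, zero_pow he.ne']
  have hmin : p = minpoly ℝ μ := minpoly.eq_of_irreducible_of_monic hp hμ hm
  have hπ : ∀ g : ℝ[X], AdjoinRoot.liftAlgHom (p ^ e) (Algebra.ofId ℝ ℂ) μ h0
      (AdjoinRoot.mk _ g) = aeval μ g := fun g => by
    rw [AdjoinRoot.liftAlgHom_mk]; rfl
  refine ⟨AdjoinRoot.liftAlgHom (p ^ e) (Algebra.ofId ℝ ℂ) μ h0, hπ, fun s hs => ?_⟩
  obtain ⟨g, rfl⟩ := AdjoinRoot.mk_surjective s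
  rw [hπ] at hs
  have hd : p ∣ g := by rw [hmin]; exact minpoly.dvd ℝ μ hs
  exact ⟨e, by rw [← map_pow, AdjoinRoot.mk_eq_zero]; exact pow_dvd_pow_of_dvd hd e⟩

/-- The hypothesis `hw` puts w in the image of evaluation at μ: for nonreal μ, 1 and μ span ℂ over ℝ
and evaluation is onto; for real μ its image is ℝ, so w has to be real. -/
theorem isSeriesImage_mulLeft_root (hε : 0 < ε) {p : ℝ[X]} (hp : Irreducible p) (hm : p.Monic)
    {e : ℕ} (he : 0 < e) {μ w : ℂ} (hμ : aeval μ p = 0) (h0 : taylorCoeff ε 0 w = μ)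
    (h1 : taylorCoeff ε 1 w ≠ 0) (hw : μ.im ≠ 0 ∨ ∃ x : ℝ, w = x) :
    IsSeriesImage ε (LinearMap.mulLeft ℝ (AdjoinRoot.root (p ^ e))) := by
  obtain ⟨π, hπ, hnil⟩ := exists_evalHom hp hm he hμ
  have := finiteDimensional_adjoinRoot (hm.pow e)
  have hroot : π (AdjoinRoot.root (p ^ e)) = μ := by
    rw [← AdjoinRoot.mk_X, hπ, aeval_X]
  obtain ⟨W₀, t, hW, ht⟩ : ∃ W₀ t, π W₀ = w ∧ π t = (taylorCoeff ε 1 w)⁻¹ := by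
    rcases hw with him | ⟨x, rfl⟩
    · have hsurj : ∀ z : ℂ, ∃ s, π s = z := fun z => by
        refine ⟨AdjoinRoot.mk _ (C (z.im / μ.im) * X + C (z.re - z.im / μ.im * μ.re)), ?_⟩
        rw [hπ]
        apply Complex.ext
        · simp
        · simp [him]
      exact ⟨(hsurj w).choose, (hsurj _).choose, (hsurj w).choose_spec, (hsurj _).choose_spec⟩
    · refine ⟨algebraMap ℝ _ x, algebraMap ℝ _ (taylorCoeff ε 1 x)⁻¹, ?_, ?_⟩
      · rw [AlgHom.commutes]; rfl
      · rw [AlgHom.commutes, ← ofReal_taylorCoeff hε]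
        simp
  obtain ⟨W, hW'⟩ := exists_isSeriesValue hε π hnil (a := AdjoinRoot.root (p ^ e)) (W₀ := W₀)
    (t := t) (by rw [hW, h0, hroot]) (by rw [hW, ht, inv_mul_cancel₀ h1])
  exact hW'.isSeriesImage

theorem isSeriesImage_mulLeft_root_of_lt (hε : 0 < ε) {l : ℝ} (hl : lambdaEps ε < l) {e : ℕ}
    (he : 0 < e) : IsSeriesImage ε (LinearMap.mulLeft ℝ (AdjoinRoot.root ((X - C l : ℝ[X]) ^ e))) := by
  obtain ⟨x, h0, h1⟩ := exists_regular_preimage hε hl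
  refine isSeriesImage_mulLeft_root hε (irreducible_X_sub_C l) (monic_X_sub_C l) he (μ := l) (w := x)
    (by simp) (by rw [← ofReal_taylorCoeff hε, h0]) ?_ (Or.inr ⟨x, rfl⟩)
  rw [← ofReal_taylorCoeff hε]
  exact_mod_cast h1

/-- For e = 1 the root is the scalar λ_ε, so a preimage suffices although it is critical. -/
theorem isSeriesImage_mulLeft_root_lambdaEps (hε : 0 < ε) {e : ℕ} (he : e = 1) :
    IsSeriesImage ε (LinearMap.mulLeft ℝ (AdjoinRoot.root ((X - C (lambdaEps ε) : ℝ[X]) ^ e))) := by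
  subst he
  obtain ⟨x, h0⟩ := exists_taylorCoeff_eq_lambdaEps hε
  have h := root_sub_pow_eq_zero (lambdaEps ε) 1
  have h2 : AdjoinRoot.root ((X - C (lambdaEps ε)) ^ 1) = algebraMap ℝ _ (lambdaEps ε) := by
    rw [← sub_eq_zero]
    rwa [pow_one (AdjoinRoot.root _ - _)] at h
  rw [h2, ← h0]
  exact (isSeriesValue_algebraMap hε x).isSeriesImage

theorem finiteDimensional_quadraticAlgebra {Q : Type*} [CommRing Q] [Algebra ℝ Q]
    [FiniteDimensional ℝ Q] (a b : Q) : FiniteDimensional ℝ (QuadraticAlgebra Q a b) :=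
  Module.Finite.trans Q _

/-- Adjoining i to Q = ℝ[X]/(X - l)^e gives a local algebra with residue field ℂ, which contains the
nonreal preimages of l. -/
theorem exists_isSeriesValue_quadraticAlgebra_neg_one (hε : 0 < ε) {l : ℝ} (hl : l < lambdaEps ε)
    {e : ℕ} (he : 0 < e) : ∃ W : QuadraticAlgebra (AdjoinRoot ((X - C l) ^ e)) (-1) 0,
      IsSeriesValue ε W (algebraMap _ _ (AdjoinRoot.root ((X - C l : ℝ[X]) ^ e))) := by
  have := finiteDimensional_adjoinRoot ((monic_X_sub_C l).pow e)
  have := finiteDimensional_quadraticAlgebra (-1 : AdjoinRoot ((X - C l) ^ e)) 0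
  obtain ⟨π, hπ, hnil⟩ := exists_evalHom (irreducible_X_sub_C l) (monic_X_sub_C l) he (μ := (l : ℂ))
    (by simp)
  have him : ∀ s, (π s).im = 0 := fun s => by
    obtain ⟨g, rfl⟩ := AdjoinRoot.mk_surjective s
    rw [hπ, ← Complex.coe_algebraMap, aeval_algebraMap_apply]
    simp
  let ψ : QuadraticAlgebra (AdjoinRoot ((X - C l) ^ e)) (-1) 0 →ₐ[ℝ] ℂ :=
    { toFun := fun z => π z.re + π z.im * Complex.I
      map_one' := by simp [QuadraticAlgebra.re_one, QuadraticAlgebra.im_one]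
      map_mul' := fun z z' => by
        simp only [QuadraticAlgebra.re_mul, QuadraticAlgebra.im_mul, map_add, map_mul, map_neg,
          map_one, map_zero]
        linear_combination (-(π z.im * π z'.im)) * Complex.I_sq
      map_zero' := by simp
      map_add' := fun z z' => by
        simp only [QuadraticAlgebra.re_add, QuadraticAlgebra.im_add, map_add]
        ring
      commutes' := fun r => by
        change π (algebraMap ℝ _ r) + π 0 * Complex.I = _
        rw [AlgHom.commutes]; simp }
  have hψ : ∀ z, ψ z = π z.re + π z.im * Complex.I := fun _ => rfl
  have hψnil : ∀ z, ψ z = 0 → IsNilpotent z := fun z hz => by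
    rw [hψ] at hz
    have h1 := congrArg Complex.re hz
    have h2 := congrArg Complex.im hz
    simp [him] at h1 h2
    have hre : IsNilpotent z.re := hnil _ (Complex.ext h1 (him _))
    have him' : IsNilpotent z.im := hnil _ (Complex.ext h2 (him _))
    have hz' : z = algebraMap (AdjoinRoot ((X - C l) ^ e)) _ z.re +
        algebraMap (AdjoinRoot ((X - C l) ^ e)) _ z.im * QuadraticAlgebra.omega := by
      ext <;> simp
    rw [hz']
    exact (Commute.all _ _).isNilpotent_add (hre.map _)
      ((Commute.all _ _).isNilpotent_mul_right (him'.map _))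
  have hsurj : ∀ z : ℂ, ψ ⟨algebraMap ℝ _ z.re, algebraMap ℝ _ z.im⟩ = z := fun z => by
    rw [hψ]
    simp only [AlgHom.commutes]
    exact Complex.re_add_im z
  obtain ⟨w, h0, h1⟩ := exists_nonreal_regular_preimage hε (y := (l : ℂ)) (Or.inr (by simpa using hl))
  refine exists_isSeriesValue hε ψ hψnil
    (W₀ := ⟨algebraMap ℝ _ w.re, algebraMap ℝ _ w.im⟩)
    (t := ⟨algebraMap ℝ _ (taylorCoeff ε 1 w)⁻¹.re, algebraMap ℝ _ (taylorCoeff ε 1 w)⁻¹.im⟩) ?_ ?_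
  · rw [hsurj, h0, hψ, QuadraticAlgebra.algebraMap_re, QuadraticAlgebra.algebraMap_im,
      ← AdjoinRoot.mk_X, hπ]
    simp
  · rw [hsurj, hsurj, inv_mul_cancel₀ h1]

/-- At the critical value the nilpotent X - λ_ε needs a square root, and the quadratic extension
supplies one, ω, itself nilpotent. -/
theorem exists_isSeriesValue_quadraticAlgebra_root_sub (hε : 0 < ε) (e : ℕ) :
    ∃ W : QuadraticAlgebra (AdjoinRoot ((X - C (lambdaEps ε)) ^ e))
        (AdjoinRoot.root _ - algebraMap ℝ _ (lambdaEps ε)) 0,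
      IsSeriesValue ε W (algebraMap _ _ (AdjoinRoot.root ((X - C (lambdaEps ε)) ^ e))) := by
  have := finiteDimensional_adjoinRoot ((monic_X_sub_C (lambdaEps ε)).pow e)
  set x := AdjoinRoot.root ((X - C (lambdaEps ε)) ^ e) - algebraMap ℝ _ (lambdaEps ε) with hx
  have := finiteDimensional_quadraticAlgebra x 0
  obtain ⟨w₀, h0, h1, h2⟩ := exists_minimum_point hε
  have hω : (QuadraticAlgebra.omega : QuadraticAlgebra _ x 0) ^ 2 = algebraMap _ _ x := by
    rw [sq, QuadraticAlgebra.omega_mul_omega_eq_mk]; rfl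
  obtain ⟨W, hW⟩ := exists_isSeriesValue_add_sq hε
    (ω := (QuadraticAlgebra.omega : QuadraticAlgebra _ x 0))
    ⟨2 * e, by rw [pow_mul, hω, ← map_pow, root_sub_pow_eq_zero, map_zero]⟩ h1 h2
  refine ⟨W, ?_⟩
  rw [h0, hω] at hW
  convert hW using 1
  rw [hx, map_sub, IsScalarTower.algebraMap_apply ℝ (AdjoinRoot ((X - C (lambdaEps ε)) ^ e))
    (QuadraticAlgebra _ x 0)]
  ring

/-- As a Q-module the quadratic extension is Q², and x ∈ Q acts diagonally on it, while W may mix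
the two factors. -/
theorem IsSeriesValue.isSeriesImage_pair {Q : Type*} [CommRing Q] [Algebra ℝ Q] {a b x : Q}
    {W : QuadraticAlgebra Q a b} (h : IsSeriesValue ε W (algebraMap Q _ x)) :
    IsSeriesImage ε (piEnd fun _ : Fin 2 => LinearMap.mulLeft ℝ x) := by
  refine h.isSeriesImage.of_equiv
    ((QuadraticAlgebra.linearEquivTuple (R := Q) a b).restrictScalars ℝ).symm fun f => ?_
  simp only [LinearEquiv.restrictScalars_symm_apply, QuadraticAlgebra.linearEquivTuple_symm_apply,
    piEnd_apply, LinearMap.mulLeft_apply]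
  ext <;> simp

theorem isSeriesImage_pair (hε : 0 < ε) {l : ℝ} (hl : l ≤ lambdaEps ε) {e : ℕ} (he : 0 < e) :
    IsSeriesImage ε (piEnd fun _ : Fin 2 =>
      LinearMap.mulLeft ℝ (AdjoinRoot.root ((X - C l : ℝ[X]) ^ e))) := by
  rcases hl.lt_or_eq with h | rfl
  · obtain ⟨W, hW⟩ := exists_isSeriesValue_quadraticAlgebra_neg_one hε h he
    exact hW.isSeriesImage_pair
  · obtain ⟨W, hW⟩ := exists_isSeriesValue_quadraticAlgebra_root_sub hε e
    exact hW.isSeriesImage_pair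

theorem isSeriesImage_of_equiv_fin_two (hε : 0 < ε) {l : ℝ} (hl : l ≤ lambdaEps ε) {e : ℕ}
    (he : 0 < e) {F : Type*} (σ : Fin 2 ≃ F) {q : F → ℝ[X]} (hq : ∀ i, q i = (X - C l) ^ e) :
    IsSeriesImage ε (piEnd fun i : F => LinearMap.mulLeft ℝ (AdjoinRoot.root (q i))) := by
  obtain rfl : q = fun _ => (X - C l) ^ e := funext hq
  exact (isSeriesImage_pair hε hl he).of_equiv (LinearEquiv.funCongrLeft ℝ _ σ) fun f => rfl

end Blocks

end

/-! ### Block counts, the two implications, and comparison with Jordan forms. -/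

section

open Polynomial Module

/-- The number of Jordan blocks of size `k + 1` with eigenvalue `μ`, in terms of dimensions of
kernels. -/
def blockCount {K V : Type*} [Field K] [AddCommGroup V] [Module K V] (T : End K V) (μ : K)
    (k : ℕ) : ℕ :=
  2 * kerDim T μ (k + 1) - kerDim T μ k - kerDim T μ (k + 2)

/-- The second difference 2 min(k+1, s) - min(k, s) - min(k+2, s) is 1 for s = k + 1 and 0
otherwise; hence the natural-number subtractions truncate nothing. -/
theorem blockCount_eq_card {K V : Type*} [Field K] [AddCommGroup V] [Module K V] {T : End K V}
    {μ : K} {ι : Type*} [Fintype ι] {s : ι → ℕ} {P : ι → Prop} [DecidablePred P]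
    (h : ∀ k, kerDim T μ k = ∑ i, if P i then min k (s i) else 0) (k : ℕ) :
    blockCount T μ k = (Finset.univ.filter fun i => P i ∧ s i = k + 1).card := by
  have : 2 * kerDim T μ (k + 1) = (Finset.univ.filter fun i => P i ∧ s i = k + 1).card +
      kerDim T μ k + kerDim T μ (k + 2) := by
    rw [h, h, h, Finset.card_filter, Finset.mul_sum, ← Finset.sum_add_distrib,
      ← Finset.sum_add_distrib]
    refine Finset.sum_congr rfl fun i _ => ?_
    by_cases hP : P i
    · by_cases hs : s i = k + 1 <;> simp [hP, hs]
      all_goals omega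
    · simp [hP]
  rw [blockCount]
  omega

theorem even_blockCount {K V : Type*} [Field K] [AddCommGroup V] [Module K V] {T : End K V}
    {μ : K} (h : ∀ k, Even (kerDim T μ k)) (k : ℕ) : Even (blockCount T μ k) := by
  have h0 := Nat.even_iff.1 (h k)
  have h2 := Nat.even_iff.1 (h (k + 2))
  rw [Nat.even_iff, blockCount]
  omega

section Sufficiency

theorem exists_complex_root_im_ne_zero {p : ℝ[X]} (hp : Irreducible p) (hm : p.Monic)
    (h : ∀ l : ℝ, p ≠ X - C l) : ∃ μ : ℂ, aeval μ p = 0 ∧ μ.im ≠ 0 := by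
  obtain ⟨μ, hμ⟩ := IsAlgClosed.exists_aeval_eq_zero ℂ p hp.degree_pos.ne'
  refine ⟨μ, hμ, fun him => h μ.re ?_⟩
  obtain ⟨x, rfl⟩ : ∃ x : ℝ, μ = x := ⟨μ.re, Complex.ext rfl (by simp [him])⟩
  rw [← Complex.coe_algebraMap, aeval_algebraMap_apply, Complex.coe_algebraMap,
    Complex.ofReal_eq_zero, coe_aeval_eq_eval] at hμ
  exact eq_of_monic_of_associated hm (monic_X_sub_C _)
    ((irreducible_X_sub_C x).associated_of_dvd hp (dvd_iff_isRoot.2 hμ)).symm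

/-- The cyclic factors are grouped by (p, e). The condition at λ_ε starts at k = 1, that is, at
block size 2, because blocks of size 1 with eigenvalue λ_ε are always images. -/
theorem isSeriesImage_of_even {ε : ℝ} (hε : 0 < ε) {V : Type*} [AddCommGroup V] [Module ℝ V]
    [FiniteDimensional ℝ V] (T : End ℝ V)
    (hlt : ∀ l < lambdaEps ε, ∀ k, Even (blockCount T l k))
    (heq : ∀ k, 1 ≤ k → Even (blockCount T (lambdaEps ε) k)) : IsSeriesImage ε T := by
  classical
  obtain ⟨ι, _, p, e, hp, hm, he, E, hE⟩ := exists_primary_equiv T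
  have := fun i => finiteDimensional_adjoinRoot ((hm i).pow (e i))
  have hcount : ∀ l k, blockCount T l k =
      (Finset.univ.filter fun i => p i = X - C l ∧ e i = k + 1).card := fun l k =>
    blockCount_eq_card (fun k => by
      rw [kerDim_of_equiv_pi E hE]
      exact Finset.sum_congr rfl fun i _ => kerDim_adjoinRoot_pow (hp i) (hm i) (e i) l k) k
  refine IsSeriesImage.of_equiv E
    (T' := piEnd fun i => LinearMap.mulLeft ℝ (AdjoinRoot.root (p i ^ e i)))
    (fun v => funext fun i => hE v i) ?_
  have hfin : Fintype (Set.range fun i => (p i, e i)) := Fintype.ofFinite _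
  refine isSeriesImage_piEnd_of_fibers (fun i => Set.rangeFactorization (fun i => (p i, e i)) i) ?_
  rintro ⟨_, i₀, rfl⟩
  have hfib : ∀ i, Set.rangeFactorization (fun i => (p i, e i)) i = ⟨(p i₀, e i₀), i₀, rfl⟩ ↔
      p i = p i₀ ∧ e i = e i₀ := fun i => by
    rw [Subtype.ext_iff, Set.rangeFactorization_coe, Prod.mk.injEq]
  -- Groups of this kind have an even number of members and are treated in pairs; in the others
  -- every factor is solved separately.
  by_cases hbad : ∃ l, p i₀ = X - C l ∧ (l < lambdaEps ε ∨ l = lambdaEps ε ∧ 2 ≤ e i₀)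
  · obtain ⟨l, hl, hl'⟩ := hbad
    refine isSeriesImage_piEnd_of_even ?_ fun s ⟨σ⟩ => ?_
    · have h1 : Even (blockCount T l (e i₀ - 1)) := by
        rcases hl' with h | ⟨rfl, h⟩
        · exact hlt l h _
        · exact heq _ (by omega)
      rw [hcount, Nat.sub_add_cancel (he i₀)] at h1
      rw [Fintype.card_subtype]
      convert h1 using 3 with i
      exact (hfib i).trans (by rw [hl])
    · refine isSeriesImage_of_equiv_fin_two hε (l := l) ?_ (he i₀) σ
        (q := fun i : s => p i.1.1 ^ e i.1.1) fun i => ?_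
      · rcases hl' with h | ⟨rfl, -⟩
        · exact h.le
        · exact le_rfl
      · obtain ⟨h1, h2⟩ := (hfib i.1.1).1 i.1.2
        rw [h1, h2, hl]
  · refine isSeriesImage_piEnd fun ⟨i, hi⟩ => ?_
    obtain ⟨h1, h2⟩ := (hfib i).1 hi
    rw [← h1, ← h2] at hbad
    simp only
    by_cases hlin : ∃ l, p i = X - C l
    · obtain ⟨l, hl⟩ := hlin
      have hl' : lambdaEps ε ≤ l := not_lt.1 fun h => hbad ⟨l, hl, Or.inl h⟩
      rw [hl]
      rcases hl'.lt_or_eq with h | rfl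
      · exact isSeriesImage_mulLeft_root_of_lt hε h (he i)
      · have he1 : e i = 1 := by
          have := he i
          have : ¬ 2 ≤ e i := fun h => hbad ⟨_, hl, Or.inr ⟨rfl, h⟩⟩
          omega
        exact isSeriesImage_mulLeft_root_lambdaEps hε he1
    · push Not at hlin
      obtain ⟨μ, hμ, him⟩ := exists_complex_root_im_ne_zero (hp i) (hm i) hlin
      obtain ⟨w, h0, hw1⟩ := exists_nonreal_regular_preimage hε (y := μ) (Or.inl him)
      exact isSeriesImage_mulLeft_root hε (hp i) (hm i) (he i) hμ h0 hw1 (Or.inl him)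

end Sufficiency

section Necessity

theorem exists_root_of_odd_natDegree {p : ℝ[X]} (hm : p.Monic) (hodd : Odd p.natDegree) :
    ∃ x, p.IsRoot x := by
  have hpos : 0 < p.degree := natDegree_pos_iff_degree_pos.1 hodd.pos
  have h1 := p.tendsto_atTop_of_leadingCoeff_nonneg hpos (by rw [hm]; exact zero_le_one)
  have hnd : (-(p.comp (-X))).natDegree = p.natDegree := by
    rw [natDegree_neg, natDegree_comp, natDegree_neg, natDegree_X, mul_one]
  have h2 := (-(p.comp (-X))).tendsto_atTop_of_leadingCoeff_nonneg
    (natDegree_pos_iff_degree_pos.1 (hnd ▸ hodd.pos)) (by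
      rw [leadingCoeff_neg, leadingCoeff_comp (by simp), hm.leadingCoeff, leadingCoeff_neg,
        leadingCoeff_X, hodd.neg_one_pow]
      norm_num)
  obtain ⟨b, hb⟩ := (h1.eventually_ge_atTop 0).exists
  obtain ⟨a, ha⟩ := (h2.eventually_ge_atTop 0).exists
  have ha' : p.eval (-a) ≤ 0 := by simpa using ha
  obtain ⟨x, hx⟩ := mem_range_of_exists_le_of_exists_ge p.continuous ⟨-a, ha'⟩ ⟨b, hb⟩
  exact ⟨x, hx⟩

theorem exists_hasEigenvalue_of_odd_finrank {V : Type*} [AddCommGroup V] [Module ℝ V]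
    [FiniteDimensional ℝ V] (hodd : Odd (finrank ℝ V)) (T : End ℝ V) : ∃ x, T.HasEigenvalue x := by
  obtain ⟨x, hx⟩ := exists_root_of_odd_natDegree T.charpoly_monic
    (by rwa [LinearMap.charpoly_natDegree])
  exact ⟨x, (End.hasEigenvalue_iff_isRoot_charpoly T x).2 hx⟩

theorem sub_algebraMap_pow_apply {K V : Type*} [Field K] [AddCommGroup V] [Module K V] {T : End K V}
    {x : V} {c : K} (h : T x = c • x) (μ : K) (n : ℕ) :
    ((T - algebraMap K (End K V) μ) ^ n) x = (c - μ) ^ n • x := by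
  induction n with
  | zero => simp
  | succ n ih =>
    rw [pow_succ, End.mul_apply, LinearMap.sub_apply, h, algebraMap_end_apply, ← sub_smul,
      map_smul, ih, smul_smul, pow_succ']

/-- W commutes with T and so preserves the kernel. In odd dimension it has a real eigenvector there,
on which T acts by f(w) ≥ λ_ε > μ, so (T - μ)^k cannot kill it. -/
theorem even_kerDim_of_isSeriesImage {ε : ℝ} (hε : 0 < ε) {V : Type*} [AddCommGroup V]
    [Module ℝ V] [FiniteDimensional ℝ V] {T : End ℝ V} (hT : IsSeriesImage ε T) {μ : ℝ}
    (hμ : μ < lambdaEps ε) (k : ℕ) : Even (kerDim T μ k) := by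
  obtain ⟨W, hW⟩ := hT
  have hext : ∀ x y : V, (∀ φ : Dual ℝ V, φ x = φ y) → x = y := fun x y h => by
    rw [← sub_eq_zero, ← forall_dual_apply_eq_zero_iff ℝ]
    intro φ
    rw [map_sub, h, sub_self]
  have hcomm : Commute W T := by
    ext m
    refine hext _ _ fun φ => ?_
    refine (hW m (φ ∘ₗ W)).unique ?_
    have hn : ∀ n, (φ ∘ₗ W) ((W ^ n) m) = φ ((W ^ n) (W m)) := fun n => by
      rw [LinearMap.comp_apply, ← End.mul_apply, ← End.mul_apply, ← pow_succ, ← pow_succ']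
    simp only [hn]
    exact hW (W m) φ
  set N := (T - algebraMap ℝ (End ℝ V) μ) ^ k with hN
  have hWN : Commute W N := (hcomm.sub_right (Algebra.commutes μ W).symm).pow_right k
  rw [← Nat.not_odd_iff_even]
  intro hodd
  have hinv : ∀ v ∈ LinearMap.ker N, W v ∈ LinearMap.ker N := fun v hv => by
    rw [LinearMap.mem_ker] at hv ⊢
    rw [← End.mul_apply, ← hWN.eq, End.mul_apply, hv, map_zero]
  obtain ⟨w, hw⟩ := exists_hasEigenvalue_of_odd_finrank (V := LinearMap.ker N) hodd (W.restrict hinv)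
  obtain ⟨u, hu⟩ := hw.exists_hasEigenvector
  have hWu : W u.1 = w • u.1 := congrArg Subtype.val hu.apply_eq_smul
  have hu0 : u.1 ≠ 0 := fun h => hu.2 (Subtype.ext h)
  have hWn : ∀ n, (W ^ n) u.1 = w ^ n • u.1 := fun n => by
    induction n with
    | zero => simp
    | succ n ih => rw [pow_succ, End.mul_apply, hWu, map_smul, ih, smul_smul, pow_succ']
  have hTu : T u.1 = taylorCoeff ε 0 w • u.1 := by
    refine hext _ _ fun φ => ?_
    refine (hW u.1 φ).unique ?_
    have := (hasSum_taylorCoeff_zero hε w).mul_right (φ u.1)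
    rw [map_smul, smul_eq_mul]
    convert! this using 2 with n
    rw [hWn, map_smul, smul_eq_mul, smul_eq_mul, mul_assoc]
  have hNu : N u.1 = (taylorCoeff ε 0 w - μ) ^ k • u.1 := sub_algebraMap_pow_apply hTu μ k
  have h0 : (taylorCoeff ε 0 w - μ) ^ k • u.1 = 0 := by rw [← hNu]; exact u.2
  rcases smul_eq_zero.1 h0 with h | h
  · have h3 := eq_zero_of_pow_eq_zero h
    have := lambdaEps_le_taylorCoeff hε w
    linarith
  · exact hu0 h

end Necessity

section JordanForm

/-- Real and imaginary parts identify the complex kernel with two copies of the real one; real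
dimensions are then compared. -/
theorem finrank_ker_toLin'_map_ofReal {d : ℕ} (B : Matrix (Fin d) (Fin d) ℝ) :
    finrank ℂ (LinearMap.ker (Matrix.toLin' (B.map Complex.ofReal))) =
      finrank ℝ (LinearMap.ker (Matrix.toLin' B)) := by
  have hre : ∀ v : Fin d → ℂ, (fun i => ((B.map Complex.ofReal).mulVec v i).re) =
      B.mulVec fun i => (v i).re := fun v => by
    ext i; simp [Matrix.mulVec, dotProduct]
  have him : ∀ v : Fin d → ℂ, (fun i => ((B.map Complex.ofReal).mulVec v i).im) =
      B.mulVec fun i => (v i).im := fun v => by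
    ext i; simp [Matrix.mulVec, dotProduct]
  let F : LinearMap.ker (Matrix.toLin' (B.map Complex.ofReal)) ≃ₗ[ℝ]
      LinearMap.ker (Matrix.toLin' B) × LinearMap.ker (Matrix.toLin' B) :=
    { toFun := fun v => ⟨⟨fun i => (v.1 i).re, by
          have := v.2
          rw [LinearMap.mem_ker, Matrix.toLin'_apply] at this ⊢
          rw [← hre, this]; rfl⟩, ⟨fun i => (v.1 i).im, by
          have := v.2
          rw [LinearMap.mem_ker, Matrix.toLin'_apply] at this ⊢
          rw [← him, this]; rfl⟩⟩
      map_add' := fun v w => by ext <;> simp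
      map_smul' := fun c v => by ext <;> simp
      invFun := fun xy => ⟨fun i => ⟨xy.1.1 i, xy.2.1 i⟩, by
          rw [LinearMap.mem_ker, Matrix.toLin'_apply]
          ext i
          apply Complex.ext
          · have h1 := congrFun (hre fun i => ⟨xy.1.1 i, xy.2.1 i⟩) i
            have h2 := xy.1.2
            rw [LinearMap.mem_ker, Matrix.toLin'_apply] at h2
            simp only [h2] at h1
            exact h1
          · have h1 := congrFun (him fun i => ⟨xy.1.1 i, xy.2.1 i⟩) i
            have h2 := xy.2.2
            rw [LinearMap.mem_ker, Matrix.toLin'_apply] at h2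
            simp only [h2] at h1
            exact h1⟩
      left_inv := fun v => by ext <;> simp
      right_inv := fun xy => by ext <;> simp }
  have h1 := F.finrank_eq
  rw [finrank_prod, finrank_real_of_complex] at h1
  omega

theorem toLin'_sub_algebraMap_pow {K : Type*} [Field K] {d : ℕ} (A : Matrix (Fin d) (Fin d) K)
    (μ : K) (k : ℕ) : (Matrix.toLin' A - algebraMap K (End K (Fin d → K)) μ) ^ k =
      Matrix.toLin' ((A - algebraMap K (Matrix (Fin d) (Fin d) K) μ) ^ k) := by
  have h : ∀ B : Matrix (Fin d) (Fin d) K, Matrix.toLin' B = Matrix.toLinAlgEquiv' B := fun _ => rfl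
  rw [h, h, map_pow, map_sub, AlgEquiv.commutes]

theorem kerDim_map_ofReal {d : ℕ} (A : Matrix (Fin d) (Fin d) ℝ) (μ : ℝ) (k : ℕ) :
    kerDim (Matrix.toLin' (A.map Complex.ofReal)) (μ : ℂ) k = kerDim (Matrix.toLin' A) μ k := by
  have hmap : ∀ B : Matrix (Fin d) (Fin d) ℝ,
      B.map Complex.ofReal = Complex.ofRealHom.mapMatrix B := fun _ => rfl
  have hscal : algebraMap ℂ (Matrix (Fin d) (Fin d) ℂ) μ =
      Complex.ofRealHom.mapMatrix (algebraMap ℝ (Matrix (Fin d) (Fin d) ℝ) μ) := by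
    ext i j
    by_cases hij : i = j <;> simp [Matrix.algebraMap_matrix_apply, hij]
  rw [kerDim, kerDim, toLin'_sub_algebraMap_pow, toLin'_sub_algebraMap_pow,
    ← finrank_ker_toLin'_map_ofReal, hmap, hmap,
    map_pow Complex.ofRealHom.mapMatrix, map_sub Complex.ofRealHom.mapMatrix, hscal]

theorem blockCount_map_ofReal {d : ℕ} (A : Matrix (Fin d) (Fin d) ℝ) (μ : ℝ) (k : ℕ) :
    blockCount (Matrix.toLin' (A.map Complex.ofReal)) (μ : ℂ) k =
      blockCount (Matrix.toLin' A) μ k := by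
  simp only [blockCount, kerDim_map_ofReal]

theorem jordanBlock_mulVec (k : ℕ) (μ : ℂ) (x : Fin k → ℂ) :
    (jordanBlock k μ).mulVec x = (shiftEnd ℂ k + algebraMap ℂ (End ℂ (Fin k → ℂ)) μ) x := by
  ext i
  rw [LinearMap.add_apply, Pi.add_apply, shiftEnd_apply, algebraMap_end_apply, Pi.smul_apply,
    smul_eq_mul]
  have h : ∀ j, jordanBlock k μ i j * x j = (if (i : ℕ) + 1 = (j : ℕ) then x j else 0) +
      if i = j then μ * x j else 0 := fun j => by
    rw [jordanBlock, Matrix.of_apply]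
    by_cases h1 : i = j
    · subst h1; simp
    · simp [h1]
  simp only [Matrix.mulVec, dotProduct, h, Finset.sum_add_distrib, Finset.sum_ite_eq,
    Finset.mem_univ, if_true]
  congr 1
  split_ifs with h1
  · rw [Finset.sum_eq_single ⟨(i : ℕ) + 1, h1⟩]
    · simp
    · intro j _ hj
      rw [if_neg fun h2 => hj (Fin.ext h2.symm)]
    · simp
  · exact Finset.sum_eq_zero fun j _ => if_neg (by omega)

theorem blockDiagonal'_mulVec_apply {n : ℕ} {size : Fin n → ℕ}
    (B : ∀ i, Matrix (Fin (size i)) (Fin (size i)) ℂ) (x : (Σ i, Fin (size i)) → ℂ) (i : Fin n)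
    (j : Fin (size i)) :
    (Matrix.blockDiagonal' B).mulVec x ⟨i, j⟩ = (B i).mulVec (fun j => x ⟨i, j⟩) j := by
  simp only [Matrix.mulVec, dotProduct, Fintype.sum_sigma]
  rw [Finset.sum_eq_single i]
  · simp only [Matrix.blockDiagonal'_apply_eq]
  · intro i' _ hi'
    exact Finset.sum_eq_zero fun j' _ => by
      rw [Matrix.blockDiagonal'_apply_ne _ _ _ hi'.symm, zero_mul]
  · simp

theorem kerDim_of_isJordanForm {d : ℕ} {A : Matrix (Fin d) (Fin d) ℝ} {n : ℕ} {size : Fin n → ℕ}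
    {eig : Fin n → ℂ} (h : IsJordanForm A size eig) (μ : ℂ) (k : ℕ) :
    kerDim (Matrix.toLin' (A.map Complex.ofReal)) μ k =
      ∑ i, if eig i = μ then min k (size i) else 0 := by
  obtain ⟨-, P, Q, hPQ, hQP, hA⟩ := h
  let E₁ : (Fin d → ℂ) ≃ₗ[ℂ] ((Σ i, Fin (size i)) → ℂ) := Matrix.toLin'OfInv hPQ hQP
  let E : (Fin d → ℂ) ≃ₗ[ℂ] ∀ i, (Fin (size i) → ℂ) := E₁.trans
      (LinearEquiv.piCurry ℂ fun i (_ : Fin (size i)) => ℂ)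
  have hE : ∀ v i j, E v i j = Q.mulVec v ⟨i, j⟩ := fun v i j => rfl
  rw [kerDim_of_equiv_pi E
    (B := fun i => shiftEnd ℂ (size i) + algebraMap ℂ (End ℂ (Fin (size i) → ℂ)) (eig i))]
  · exact Finset.sum_congr rfl fun i _ => kerDim_shiftEnd_add (size i) μ (eig i) k
  · intro v i
    ext j
    rw [hE, Matrix.toLin'_apply, hA, Matrix.mulVec_mulVec, Matrix.mul_assoc P, ← Matrix.mul_assoc Q,
      hQP, Matrix.one_mul, ← Matrix.mulVec_mulVec, blockDiagonal'_mulVec_apply, jordanBlock_mulVec]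
    rfl

theorem blockCount_of_isJordanForm {d : ℕ} {A : Matrix (Fin d) (Fin d) ℝ} {n : ℕ}
    {size : Fin n → ℕ} {eig : Fin n → ℂ} (h : IsJordanForm A size eig) (μ : ℝ) (k : ℕ) :
    blockCount (Matrix.toLin' A) μ k = Set.ncard {i : Fin n | size i = k + 1 ∧ eig i = μ} := by
  rw [← blockCount_map_ofReal, blockCount_eq_card (kerDim_of_isJordanForm h μ) k,
    ← Set.ncard_coe_finset]
  congr 1
  ext i
  simp [and_comm]

theorem blocksOccurEvenly_iff {d : ℕ} {A : Matrix (Fin d) (Fin d) ℝ} {n : ℕ}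
    {size : Fin n → ℕ} {eig : Fin n → ℂ} (h : IsJordanForm A size eig) (μ : ℝ) :
    BlocksOccurEvenly size eig (μ : ℂ) ↔ ∀ k, Even (blockCount (Matrix.toLin' A) μ k) := by
  constructor
  · intro hb k
    rw [blockCount_of_isJordanForm h]
    exact hb (k + 1)
  · rintro hb (_ | k)
    · have : {i : Fin n | size i = 0 ∧ eig i = μ} = ∅ := by
        ext i
        simp [(h.1 i).ne']
      rw [this]
      simp
    · rw [← blockCount_of_isJordanForm h]
      exact hb k

/-- Over ℂ every irreducible factor is linear, so each primary piece is a Jordan block in the basis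
of powers of X - μ. -/
theorem exists_isJordanForm {d : ℕ} (A : Matrix (Fin d) (Fin d) ℝ) :
    ∃ (n : ℕ) (size : Fin n → ℕ) (eig : Fin n → ℂ), IsJordanForm A size eig := by
  obtain ⟨ι, _, p, e, hp, hm, he, E, hE⟩ :=
    exists_primary_equiv (Matrix.toLin' (A.map Complex.ofReal))
  have hlin : ∀ i, ∃ μ, p i = X - C μ := fun i => by
    obtain ⟨μ, hμ⟩ := IsAlgClosed.exists_root (p i) (hp i).degree_pos.ne'
    exact ⟨μ, eq_of_monic_of_associated (hm i) (monic_X_sub_C _)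
      ((irreducible_X_sub_C μ).associated_of_dvd (hp i) (dvd_iff_isRoot.2 hμ)).symm⟩
  choose μ hμ using hlin
  obtain rfl : p = fun i => X - C (μ i) := funext hμ
  choose F hF using fun i => exists_equiv_adjoinRoot_pow (μ i) (e i)
  let σ := (Fintype.equivFin ι).symm
  let size : Fin (Fintype.card ι) → ℕ := fun a => e (σ a)
  let G : (Fin d → ℂ) ≃ₗ[ℂ] ((Σ a, Fin (size a)) → ℂ) :=
    ((E.trans (LinearEquiv.piCongrRight F)).trans
      (LinearEquiv.piCongrLeft' ℂ (fun i => Fin (e i) → ℂ) σ.symm)).trans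
      (LinearEquiv.piCurry ℂ fun a (_ : Fin (size a)) => ℂ).symm
  have hG : ∀ v a j, G v ⟨a, j⟩ = F (σ a) (E v (σ a)) j := fun v a j => rfl
  refine ⟨Fintype.card ι, size, fun a => μ (σ a), fun a => he _,
    LinearMap.toMatrix' (G.symm : _ →ₗ[ℂ] _), LinearMap.toMatrix' (G : _ →ₗ[ℂ] _), ?_, ?_, ?_⟩
  · rw [← LinearMap.toMatrix'_comp]
    simp
  · rw [← LinearMap.toMatrix'_comp]
    simp
  · apply Matrix.toLin'.injective
    ext1 x
    rw [Matrix.toLin'_mul, Matrix.toLin'_mul, Matrix.toLin'_toMatrix', Matrix.toLin'_toMatrix']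
    refine LinearMap.ext fun v => ?_
    simp only [LinearMap.comp_apply, LinearEquiv.coe_coe]
    rw [← LinearEquiv.symm_apply_eq, LinearEquiv.symm_symm, Matrix.toLin'_apply (Matrix.blockDiagonal' _)]
    ext ⟨a, j⟩
    rw [hG, hE, blockDiagonal'_mulVec_apply, jordanBlock_mulVec]
    exact congrFun (hF (σ a) _) j

end JordanForm

end

/-! ### The diagonalizable case, and passage from endomorphisms to matrices. -/

section

open Polynomial Module

section Diagonalizable

theorem kerDim_of_map_ofReal_eq_diagonal {d : ℕ} {D : Matrix (Fin d) (Fin d) ℝ}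
    {P Q : Matrix (Fin d) (Fin d) ℂ} {w : Fin d → ℂ} (hPQ : P * Q = 1) (hQP : Q * P = 1)
    (hD : D.map Complex.ofReal = P * Matrix.diagonal w * Q) (μ : ℂ) (k : ℕ) :
    kerDim (Matrix.toLin' (D.map Complex.ofReal)) μ k = ∑ i, if w i = μ then min k 1 else 0 := by
  let E₁ : (Fin d → ℂ) ≃ₗ[ℂ] (Fin d → ℂ) := Matrix.toLin'OfInv hPQ hQP
  let E : (Fin d → ℂ) ≃ₗ[ℂ] (Fin d → Fin 1 → ℂ) := E₁.trans
    (LinearEquiv.piCongrRight fun _ => (LinearEquiv.funUnique (Fin 1) ℂ ℂ).symm)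
  have hE : ∀ v i j, E v i j = Q.mulVec v i := fun v i j => rfl
  rw [kerDim_of_equiv_pi E
    (B := fun i => shiftEnd ℂ 1 + algebraMap ℂ (End ℂ (Fin 1 → ℂ)) (w i))]
  · exact Finset.sum_congr rfl fun i _ => kerDim_shiftEnd_add 1 μ (w i) k
  · intro v i
    ext j
    rw [hE, Matrix.toLin'_apply, hD, Matrix.mulVec_mulVec, Matrix.mul_assoc P, ← Matrix.mul_assoc Q,
      hQP, Matrix.one_mul, ← Matrix.mulVec_mulVec, Matrix.mulVec_diagonal, LinearMap.add_apply,
      Pi.add_apply, shiftEnd_apply, dif_neg (by omega), zero_add, algebraMap_end_apply,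
      Pi.smul_apply, hE, smul_eq_mul]

theorem rootMultiplicity_charpoly_of_map_ofReal_eq_diagonal {d : ℕ}
    {D : Matrix (Fin d) (Fin d) ℝ} {P Q : Matrix (Fin d) (Fin d) ℂ} {w : Fin d → ℂ}
    (hQP : Q * P = 1) (hD : D.map Complex.ofReal = P * Matrix.diagonal w * Q) (μ : ℝ) :
    D.charpoly.rootMultiplicity μ = (Finset.univ.filter fun i => w i = (μ : ℂ)).card := by
  have h1 : D.charpoly.map Complex.ofRealHom = ∏ i, (X - C (w i)) := by
    rw [← Matrix.charpoly_map, ← Matrix.charpoly_diagonal]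
    change (D.map Complex.ofReal).charpoly = _
    rw [hD, Matrix.charpoly_mul_comm, ← Matrix.mul_assoc, hQP, Matrix.one_mul]
  have h2 : ∏ i, (X - C (w i)) = ((Finset.univ.val.map w).map fun a => X - C a).prod := by
    rw [Multiset.map_map]
    rfl
  rw [eq_rootMultiplicity_map Complex.ofRealHom.injective, h1, h2, ← count_roots,
    roots_multiset_prod_X_sub_C, Multiset.count_map, Finset.card_def, Finset.filter_val]
  congr 1
  exact Multiset.filter_congr fun i _ => eq_comm

/-- All blocks have size 1 and their number is the algebraic multiplicity. The condition at λ_ε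
concerns only larger blocks and is vacuous, so the criterion becomes an equivalence. -/
theorem isSeriesImage_iff_of_isDiagonalizableOverComplex {ε : ℝ} (hε : 0 < ε) {d : ℕ}
    {D : Matrix (Fin d) (Fin d) ℝ} (hD : IsDiagonalizableOverComplex D) :
    IsSeriesImage ε (Matrix.toLin' D) ↔ ∀ μ : ℝ, End.HasEigenvalue (Matrix.toLin' D) μ →
      μ < lambdaEps ε → Even (D.charpoly.rootMultiplicity μ) := by
  obtain ⟨P, Q, w, hPQ, hQP, hD⟩ := hD
  have hcount : ∀ (μ : ℝ) k, blockCount (Matrix.toLin' D) μ k =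
      (Finset.univ.filter fun i => w i = μ ∧ 1 = k + 1).card := fun μ k => by
    rw [← blockCount_map_ofReal]
    exact blockCount_eq_card (kerDim_of_map_ofReal_eq_diagonal hPQ hQP hD μ) k
  have hpos : ∀ μ k, 1 ≤ k → blockCount (Matrix.toLin' D) μ k = 0 := fun μ k hk => by
    rw [hcount, Finset.card_eq_zero, Finset.filter_eq_empty_iff]
    omega
  have hzero : ∀ μ, blockCount (Matrix.toLin' D) μ 0 = D.charpoly.rootMultiplicity μ := fun μ => by
    rw [hcount, rootMultiplicity_charpoly_of_map_ofReal_eq_diagonal hQP hD]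
    simp
  constructor
  · intro h μ _ hμ
    rw [← hzero]
    exact even_blockCount (even_kerDim_of_isSeriesImage hε h hμ) 0
  · intro h
    refine isSeriesImage_of_even hε _ (fun μ hμ k => ?_) fun k hk => ?_
    · rcases Nat.eq_zero_or_pos k with rfl | hk
      · rw [hzero]
        by_cases hev : End.HasEigenvalue (Matrix.toLin' D) μ
        · exact h μ hev hμ
        · rw [End.hasEigenvalue_iff_isRoot_charpoly, Matrix.charpoly_toLin'] at hev
          rw [rootMultiplicity_eq_zero hev]
          exact Even.zero
      · rw [hpos μ k hk]
        exact Even.zero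
    · rw [hpos _ k hk]
      exact Even.zero

end Diagonalizable

section Matrices

theorem hasSum_mulVec {d : ℕ} {f : ℕ → Matrix (Fin d) (Fin d) ℝ} {B : Matrix (Fin d) (Fin d) ℝ}
    (h : HasSum f B) (x : Fin d → ℝ) : HasSum (fun n => (f n).mulVec x) (B.mulVec x) := by
  let φ : Matrix (Fin d) (Fin d) ℝ →+ (Fin d → ℝ) :=
    { toFun := fun M => M.mulVec x
      map_zero' := Matrix.zero_mulVec x
      map_add' := fun M N => Matrix.add_mulVec M N x }
  exact h.map φ (Continuous.matrix_mulVec continuous_id continuous_const)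

theorem toLin'_pow_apply {d : ℕ} (W : Matrix (Fin d) (Fin d) ℝ) (n : ℕ) (x : Fin d → ℝ) :
    (Matrix.toLin' W ^ n) x = (W ^ n).mulVec x := by
  rw [← Matrix.toLin'_pow, Matrix.toLin'_apply]

theorem isSeriesImage_toLin'_iff {ε : ℝ} {d : ℕ} {A : Matrix (Fin d) (Fin d) ℝ} :
    IsSeriesImage ε (Matrix.toLin' A) ↔
      ∃ W : Matrix (Fin d) (Fin d) ℝ, HasSum (fun n => coef ε n • W ^ n) A := by
  constructor
  · rintro ⟨W, hW⟩
    obtain ⟨W, rfl⟩ := Matrix.toLin'.surjective W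
    refine ⟨W, Pi.hasSum.2 fun i => Pi.hasSum.2 fun j => ?_⟩
    have := hW (Pi.single j 1) (LinearMap.proj i)
    simpa only [toLin'_pow_apply, Matrix.toLin'_apply, LinearMap.proj_apply,
      Matrix.mulVec_single_one, Matrix.col_apply, Matrix.smul_apply, smul_eq_mul] using this
  · rintro ⟨W, hW⟩
    refine ⟨Matrix.toLin' W, fun x φ => ?_⟩
    have := (hasSum_mulVec hW x).map φ φ.continuous_of_finiteDimensional
    simpa only [Function.comp_def, Matrix.smul_mulVec, map_smul, smul_eq_mul, toLin'_pow_apply,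
      Matrix.toLin'_apply] using this

end Matrices

end

/-! ### The differential equation and its time-one map. -/

section

open Set

section Series

/-- The argument of the power series of `Ψ_ε(θ)`. -/
def seriesArg {d : ℕ} (ε : ℝ) (θ : Matrix (Fin d) (Fin d) ℝ) : Matrix (Fin d) (Fin d) ℝ :=
  (1 / ε) • θ + (1 / (4 * ε ^ 2)) • (1 : Matrix (Fin d) (Fin d) ℝ)

theorem exp_smul_psiTerm {d : ℕ} (ε : ℝ) (θ : Matrix (Fin d) (Fin d) ℝ) (n : ℕ) :
    Real.exp (-(1 / (2 * ε))) • psiTerm ε θ n = coef ε n • seriesArg ε θ ^ n := by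
  rw [psiTerm, smul_smul]
  rfl

theorem exists_seriesArg_eq {d : ℕ} {ε : ℝ} (hε : 0 < ε) (W : Matrix (Fin d) (Fin d) ℝ) :
    ∃ θ, seriesArg ε θ = W := by
  refine ⟨ε • (W - (1 / (4 * ε ^ 2)) • 1), ?_⟩
  rw [seriesArg, smul_smul, one_div_mul_cancel hε.ne', one_smul, sub_add_cancel]

attribute [local instance] Matrix.linftyOpNormedRing Matrix.linftyOpNormedAlgebra in
theorem summable_coef_smul_pow {d : ℕ} {ε : ℝ} (hε : 0 < ε) (W : Matrix (Fin d) (Fin d) ℝ) :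
    Summable fun n => coef ε n • W ^ n :=
  (hasSum_taylorCoeff_zero hε W).summable

theorem summable_psiTerm {d : ℕ} {ε : ℝ} (hε : 0 < ε) (θ : Matrix (Fin d) (Fin d) ℝ) :
    Summable (psiTerm ε θ) := by
  have := (summable_coef_smul_pow hε (seriesArg ε θ)).const_smul (Real.exp (-(1 / (2 * ε))))⁻¹
  simpa only [← exp_smul_psiTerm, inv_smul_smul₀ (Real.exp_ne_zero _)] using this

theorem hasSum_psi {d : ℕ} {ε : ℝ} (hε : 0 < ε) (θ : Matrix (Fin d) (Fin d) ℝ) :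
    HasSum (fun n => coef ε n • seriesArg ε θ ^ n) (psi ε θ) := by
  simp only [← exp_smul_psiTerm]
  exact (summable_psiTerm hε θ).hasSum.const_smul _

end Series

theorem hasSum_add_consecutive {E : Type*} [NormedAddCommGroup E] [CompleteSpace E] {f : ℕ → E} {s : E} (h : HasSum f s) :
    HasSum (fun n => f (2 * n) + f (2 * n + 1)) s := by
  have he : HasSum (fun n => f (2 * n)) _ := (h.summable.comp_injective (i := fun n : ℕ => 2 * n)
    (mul_right_injective₀ two_ne_zero)).hasSum
  have ho : HasSum (fun n => f (2 * n + 1)) _ :=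
    (h.summable.comp_injective (i := fun n : ℕ => 2 * n + 1) fun a b h => by simpa using h).hasSum
  rw [h.unique (he.even_add_odd ho)]
  exact he.add ho

section Flow

variable {E : Type*} [NormedAddCommGroup E] [NormedSpace ℝ E]

/-- The first-order system `(y, z)' = (z, W y)` that is equivalent to `y'' = W y`. -/
def companionOp (W : E →L[ℝ] E) : (E × E) →L[ℝ] (E × E) :=
  (ContinuousLinearMap.snd ℝ E E).prod (W.comp (ContinuousLinearMap.fst ℝ E E))

/-- The square of the companion operator is W on both components. Even and odd terms of its
exponential therefore give the two parts of `coef`. -/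
theorem companionOp_pow_two_mul (W : E →L[ℝ] E) (n : ℕ) (p : E × E) :
    (companionOp W ^ (2 * n)) p = ((W ^ n) p.1, (W ^ n) p.2) := by
  induction n generalizing p with
  | zero => rfl
  | succ n ih =>
    rw [mul_add, mul_one, pow_add, mul_apply_eq_comp, ih, pow_succ W]
    rfl

theorem companionOp_pow_two_mul_add_one (W : E →L[ℝ] E) (n : ℕ) (p : E × E) :
    (companionOp W ^ (2 * n + 1)) p = ((W ^ n) p.2, (W ^ n) (W p.1)) := by
  rw [pow_succ, mul_apply_eq_comp, companionOp_pow_two_mul]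
  rfl

variable [CompleteSpace E]

theorem hasDerivAt_exp_companionOp (W : E →L[ℝ] E) (p : E × E) (t : ℝ) :
    HasDerivAt (fun t : ℝ => NormedSpace.exp (t • companionOp W) p)
      (companionOp W (NormedSpace.exp (t • companionOp W) p)) t := by
  exact (ContinuousLinearMap.apply ℝ (E × E) p).hasFDerivAt.comp_hasDerivAt t
    (hasDerivAt_exp_smul_const' (𝕂 := ℝ) (companionOp W) t)

/-- `y(1)` for the solution of `y'' = W y`, `y(0) = x`, `y'(0) = c x`, as a power series in `W`. -/
theorem hasSum_exp_companionOp (W : E →L[ℝ] E) (c : ℝ) (x : E) :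
    HasSum (fun n : ℕ => ((1 / ((2 * n).factorial : ℝ)) + c / ((2 * n + 1).factorial : ℝ)) •
      (W ^ n) x) (NormedSpace.exp (companionOp W) (x, c • x)).1 := by
  have h0 := hasSum_add_consecutive
    (((NormedSpace.exp_series_hasSum_exp' (𝕂 := ℝ) (companionOp W)).mapL
      (ContinuousLinearMap.apply ℝ (E × E) (x, c • x))).mapL (ContinuousLinearMap.fst ℝ E E))
  refine h0.congr_fun fun n => ?_
  simp only [ContinuousLinearMap.apply_apply, ContinuousLinearMap.coe_fst',
    companionOp_pow_two_mul, companionOp_pow_two_mul_add_one, map_smul, smul_smul,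
    ← add_smul]
  congr 1
  ring

end Flow

section TimeOneMap

variable {d : ℕ} {ε : ℝ}

/-- The damping is removed by x = e^{-ct} y with c = 1/(2ε). Then y'' = W y, and x'(0) = 0 becomes
y'(0) = c x₀. -/
theorem exists_isSolution (hε : 0 < ε) (θ : Matrix (Fin d) (Fin d) ℝ) (x₀ : Fin d → ℝ) :
    ∃ x, IsSolution ε θ x₀ x ∧ x 1 = (psi ε θ).mulVec x₀ := by
  obtain ⟨c, hc⟩ : ∃ c : ℝ, c = 1 / (2 * ε) := ⟨_, rfl⟩
  have hc2 : 2 * ε * c = 1 := by rw [hc]; field_simp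
  set W : (Fin d → ℝ) →L[ℝ] (Fin d → ℝ) :=
    LinearMap.toContinuousLinearMap (Matrix.toLin' (seriesArg ε θ)) with hW
  have hWn : ∀ n x, (W ^ n) x = (seriesArg ε θ ^ n).mulVec x := fun n => by
    induction n with
    | zero => intro x; simp
    | succ n ih =>
      intro x
      rw [pow_succ, mul_apply_eq_comp, ih, pow_succ, ← Matrix.mulVec_mulVec]
      rfl
  let y : ℝ → (Fin d → ℝ) × (Fin d → ℝ) := fun t => NormedSpace.exp (t • companionOp W) (x₀, c • x₀)
  have hy : ∀ t, HasDerivAt y (companionOp W (y t)) t := hasDerivAt_exp_companionOp W _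
  have hy1 : ∀ t, HasDerivAt (fun t => (y t).1) (y t).2 t := fun t => (hy t).fst
  have hy2 : ∀ t, HasDerivAt (fun t => (y t).2) (W (y t).1) t := fun t => (hy t).snd
  have hy0 : y 0 = (x₀, c • x₀) := by simp [y]
  have he : ∀ t, HasDerivAt (fun t => Real.exp (-(c * t))) (-(c * Real.exp (-(c * t)))) t :=
    fun t => by
      have := (((hasDerivAt_id t).const_mul c).neg).exp
      convert! this using 1
      simp; ring
  refine ⟨fun t => Real.exp (-(c * t)) • (y t).1, ⟨fun t => Real.exp (-(c * t)) • ((y t).2 - c • (y t).1),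
    fun t => Real.exp (-(c * t)) • (W (y t).1 - (2 * c) • (y t).2 + (c * c) • (y t).1),
    fun t _ => ?_, fun t _ => ?_, fun t _ => ?_, ?_, ?_⟩, ?_⟩
  · convert! ((he t).smul (hy1 t)).hasDerivWithinAt using 1
    module
  · convert! ((he t).smul ((hy2 t).sub ((hy1 t).const_smul c))).hasDerivWithinAt using 1
    simp only [Pi.sub_apply, Pi.smul_apply]
    module
  · have h1 : ε • W (y t).1 = θ.mulVec (y t).1 + (ε * (c * c)) • (y t).1 := by
      have : W (y t).1 = (seriesArg ε θ).mulVec (y t).1 := rfl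
      rw [this, seriesArg, Matrix.add_mulVec, Matrix.smul_mulVec, Matrix.smul_mulVec,
        Matrix.one_mulVec, smul_add, smul_smul, smul_smul, mul_one_div_cancel hε.ne', one_smul]
      congr 2
      rw [hc]
      field_simp
      norm_num
    rw [Matrix.mulVec_smul, ← sub_eq_iff_eq_add.2 h1]
    have h2 : (2 * ε * c) • ((y t).2 - c • (y t).1) = (y t).2 - c • (y t).1 := by
      rw [hc2, one_smul]
    linear_combination (norm := module) (-Real.exp (-(c * t))) • h2
  · simp [hy0]
  · simp [hy0]
  · have h1 := hasSum_mulVec (hasSum_psi hε θ) x₀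
    have h2 := (hasSum_exp_companionOp W c x₀).const_smul (Real.exp (-c))
    simp only [y, one_smul, mul_one]
    refine h2.unique ?_
    convert! h1 using 2 with n
    rw [hWn, Matrix.smul_mulVec, smul_smul, coef, ← hc]
    congr 3
    rw [hc]
    field_simp

/-- The pair (x, x') solves a linear, hence Lipschitz, first-order system. -/
theorem IsSolution.eq_at_one (hε : 0 < ε) {θ : Matrix (Fin d) (Fin d) ℝ} {x₀ : Fin d → ℝ}
    {x x' : ℝ → Fin d → ℝ} (h : IsSolution ε θ x₀ x) (h' : IsSolution ε θ x₀ x') : x 1 = x' 1 := by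
  let L : ((Fin d → ℝ) × (Fin d → ℝ)) →L[ℝ] ((Fin d → ℝ) × (Fin d → ℝ)) :=
    (ContinuousLinearMap.snd ℝ _ _).prod (ε⁻¹ •
      ((LinearMap.toContinuousLinearMap (Matrix.toLin' θ)).comp (ContinuousLinearMap.fst ℝ _ _) -
        ContinuousLinearMap.snd ℝ _ _))
  have hL : ∀ p, L p = (p.2, ε⁻¹ • (θ.mulVec p.1 - p.2)) := fun p => rfl
  have key : ∀ {x : ℝ → Fin d → ℝ}, IsSolution ε θ x₀ x → ∃ z : ℝ → (Fin d → ℝ) × (Fin d → ℝ),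
      (∀ t, (z t).1 = x t) ∧ z 0 = (x₀, 0) ∧
      ∀ t ∈ Icc (0 : ℝ) 1, HasDerivWithinAt z (L (z t)) (Icc 0 1) t := by
    rintro x ⟨v, a, hx, hv, ha, hx0, hv0⟩
    refine ⟨fun t => (x t, v t), fun t => rfl, Prod.ext hx0 hv0, fun t ht => ?_⟩
    convert! (hx t ht).prodMk (hv t ht) using 1
    rw [hL, ← ha t ht, add_sub_cancel_right, inv_smul_smul₀ hε.ne']
  obtain ⟨z, hz, hz0, hzd⟩ := key h
  obtain ⟨z', hz', hz0', hzd'⟩ := key h'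
  have hIci : ∀ {z : ℝ → (Fin d → ℝ) × (Fin d → ℝ)},
      (∀ t ∈ Icc (0 : ℝ) 1, HasDerivWithinAt z (L (z t)) (Icc 0 1) t) →
      ∀ t ∈ Ico (0 : ℝ) 1, HasDerivWithinAt z (L (z t)) (Ici t) t := fun h t ht =>
    (h t (Ico_subset_Icc_self ht)).mono_of_mem_nhdsWithin (Icc_mem_nhdsGE_of_mem ht)
  have := ODE_solution_unique (v := fun _ => L) (K := ‖L‖₊) (fun _ => L.lipschitz)
    (fun t ht => (hzd t ht).continuousWithinAt) (hIci hzd)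
    (fun t ht => (hzd' t ht).continuousWithinAt) (hIci hzd') (hz0.trans hz0'.symm)
    (right_mem_Icc.2 zero_le_one)
  rw [← hz, ← hz', this]

theorem isTimeOneMap_iff (hε : 0 < ε) (θ D : Matrix (Fin d) (Fin d) ℝ) :
    IsTimeOneMap ε θ D ↔ D = psi ε θ := by
  constructor
  · intro h
    apply Matrix.toLin'.injective
    refine LinearMap.ext fun x₀ => ?_
    obtain ⟨x, hx, hx1⟩ := exists_isSolution hε θ x₀
    rw [Matrix.toLin'_apply, Matrix.toLin'_apply, ← hx1, (h x₀).2 x hx]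
  · rintro rfl x₀
    obtain ⟨x, hx, hx1⟩ := exists_isSolution hε θ x₀
    exact ⟨⟨x, hx⟩, fun x' hx' => by rw [← hx1, hx'.eq_at_one hε hx]⟩

theorem isRepresented_iff (hε : 0 < ε) (A : Matrix (Fin d) (Fin d) ℝ) :
    IsRepresented ε A ↔ IsSeriesImage ε (Matrix.toLin' A) := by
  rw [isSeriesImage_toLin'_iff]
  constructor
  · rintro ⟨θ, h⟩
    rw [(isTimeOneMap_iff hε θ A).1 h]
    exact ⟨seriesArg ε θ, hasSum_psi hε θ⟩
  · rintro ⟨W, hW⟩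
    obtain ⟨θ, rfl⟩ := exists_seriesArg_eq hε W
    exact ⟨θ, (isTimeOneMap_iff hε θ A).2 (hW.unique (hasSum_psi hε θ))⟩

end TimeOneMap

end

end SecondOrderLinear

end

theorem theorem1 (ε : ℝ) (hε : 0 < ε) (d : ℕ) :
    -- the minimum that defines `λ_ε` is attained
    IsLeast (Set.range (SecondOrderLinear.G ε)) (SecondOrderLinear.lambdaEps ε) ∧
    -- the series of `Ψ_ε(θ)` converges, and `Ψ_ε(θ)` is the time-one map
    (∀ θ : Matrix (Fin d) (Fin d) ℝ, Summable (SecondOrderLinear.psiTerm ε θ) ∧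
      ∀ D : Matrix (Fin d) (Fin d) ℝ,
        SecondOrderLinear.IsTimeOneMap ε θ D ↔ D = SecondOrderLinear.psi ε θ) ∧
    -- the case of matrices that are diagonalizable over `ℂ`
    (∀ D : Matrix (Fin d) (Fin d) ℝ, SecondOrderLinear.IsDiagonalizableOverComplex D →
      (SecondOrderLinear.IsRepresented ε D ↔
        ∀ μ : ℝ, Module.End.HasEigenvalue (Matrix.toLin' D) μ →
          μ < SecondOrderLinear.lambdaEps ε → Even (D.charpoly.rootMultiplicity μ))) ∧
    -- the general case
    (∀ A : Matrix (Fin d) (Fin d) ℝ,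
      (∃ (n : ℕ) (size : Fin n → ℕ) (eig : Fin n → ℂ),
        SecondOrderLinear.IsJordanForm A size eig) ∧
      ∀ (n : ℕ) (size : Fin n → ℕ) (eig : Fin n → ℂ),
        SecondOrderLinear.IsJordanForm A size eig →
        (SecondOrderLinear.IsRepresented ε A →
          ∀ μ : ℝ, μ < SecondOrderLinear.lambdaEps ε →
            SecondOrderLinear.BlocksOccurEvenly size eig (μ : ℂ)) ∧
        ((∀ μ : ℝ, μ ≤ SecondOrderLinear.lambdaEps ε →
            SecondOrderLinear.BlocksOccurEvenly size eig (μ : ℂ)) →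
          SecondOrderLinear.IsRepresented ε A)) := by
  refine ⟨SecondOrderLinear.isLeast_lambdaEps hε,
    fun θ => ⟨SecondOrderLinear.summable_psiTerm hε θ, SecondOrderLinear.isTimeOneMap_iff hε θ⟩,
    fun D hD => ?_, fun A => ⟨SecondOrderLinear.exists_isJordanForm A, fun n size eig hJ => ⟨?_, ?_⟩⟩⟩
  · rw [SecondOrderLinear.isRepresented_iff hε]
    exact SecondOrderLinear.isSeriesImage_iff_of_isDiagonalizableOverComplex hε hD
  · intro hA μ hμ
    rw [SecondOrderLinear.isRepresented_iff hε] at hA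
    rw [SecondOrderLinear.blocksOccurEvenly_iff hJ]
    exact SecondOrderLinear.even_blockCount
      (SecondOrderLinear.even_kerDim_of_isSeriesImage hε hA hμ)
  · intro h
    simp only [SecondOrderLinear.blocksOccurEvenly_iff hJ] at h
    rw [SecondOrderLinear.isRepresented_iff hε]
    exact SecondOrderLinear.isSeriesImage_of_even hε _ (fun μ hμ => h μ hμ.le)
      fun k _ => h _ le_rfl k
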